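/- Let $0\le b_1\le b_2<\infty$ with $b_2>0$, and let $\mathbb A$ be the set of all $B\in L^\infty((0,1);\mathbb R)$ with $b_1\le B\le b_2$ a.e. For $B\in\mathbb A$ let $K(B)$ be the set of quasi-eigenvalues of $B$, i.e. of all $\kappa\in\mathbb C\setminus\{0\}$ for which the problem $$y''(x)+\kappa^2B(x)y(x)=0\ \text{ for a.e. } x\in(0,1),\qquad y'(0)=0,\qquad y(1)-\frac{i\,y'(1)}{\kappa}=0$$ has a solution $y:[0,1]\to\mathbb C$, $y\not\equiv0$ (with $y$ differentiable and $y'$ absolutely continuous on $[0,1]$). For $\alpha\in\mathbb R$ put $$I(\alpha)=\inf\Big\{\operatorname{Im}\kappa:\ \kappa\in\bigcup_{B\in\mathbb A}K(B),\ \operatorname{Re}\kappa=\alpha\Big\},$$ with $I(\alpha)=+\infty$ if there is no such $\kappa$. A structure $B\in\mathbb A$ is called optimal for the frequency $\alpha$ if $I(\alpha)$ is finite and $\alpha+i\,I(\alpha)\in K(B)$. **Theorem 2.2.** Let $\alpha\in\mathbb R$ and let $B$ be an optimal structure for the frequency $\alpha$. Then $B$ is an extreme point of $\mathbb A$, and each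 of the sets $\{x\in[0,1]:B(x)=b_1\}$ and $\{x\in[0,1]:B(x)=b_2\}$ is, up to a set of measure zero, a union of finitely many intervals. That is, after correction on a set of measure zero, $B$ is a piecewise constant function on $[0,1]$ taking only the values $b_1$ and $b_2$: there is a partition $0=x_0<x_1<\dots<x_n<x_{n+1}=1$ such that the corrected $B$ is constant on each interval $(x_{j-1},x_j)$. -/

import Mathlib

open MeasureTheory Set
open scoped ENNReal

namespace QuasiEig

/-- Lebesgue measure on the interval `(0,1)`. -/
noncomputable abbrev vol01 : Measure ℝ := volume.restrict (Ioo (0 : ℝ) 1)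

/-- The real Lebesgue space `L^∞(0,1)` (classes of functions modulo a.e. equality). -/
abbrev LInf01 : Type := Lp ℝ ∞ vol01

/-- The admissible family: all `B ∈ L^∞(0,1)` with `b₁ ≤ B ≤ b₂` a.e. -/
def Ad (b₁ b₂ : ℝ) : Set LInf01 :=
  {B | ∀ᵐ x ∂vol01, b₁ ≤ B x ∧ B x ≤ b₂}

/-- `y` is a solution, with derivative `v` on `[0,1]`, of the boundary value problem
`y'' + κ² B y = 0` on `(0,1)`, `y'(0) = 0`, `y(1) - i y'(1) / κ = 0`.
As usual for merely bounded `B`, this means that `y` is differentiable on `[0,1]`, `y'` is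
absolutely continuous on `[0,1]`, and the differential equation holds almost everywhere. -/
structure IsSolution (κ : ℂ) (B : LInf01) (y v : ℝ → ℂ) : Prop where
  hasDeriv : ∀ x ∈ Icc (0 : ℝ) 1, HasDerivWithinAt y (v x) (Icc 0 1) x
  absCont : AbsolutelyContinuousOnInterval v 0 1
  equation : ∀ᵐ x ∂vol01, HasDerivAt v (-(κ ^ 2 * (B x : ℂ) * y x)) x
  bc_zero : v 0 = 0
  bc_one : y 1 - Complex.I * v 1 / κ = 0

/-- The set `K(B)` of quasi-eigenvalues of `B`: those `κ` (necessarily nonzero, because of the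
division by `κ` in the boundary condition) for which the problem has a solution that is not
identically zero on `[0,1]`. -/
def K (B : LInf01) : Set ℂ :=
  {κ | κ ≠ 0 ∧ ∃ y v : ℝ → ℂ, IsSolution κ B y v ∧ ∃ x ∈ Icc (0 : ℝ) 1, y x ≠ 0}

/-- The set of all quasi-eigenvalues of all admissible structures. -/
def KAd (b₁ b₂ : ℝ) : Set ℂ := ⋃ B ∈ Ad b₁ b₂, K B

/-- `I(α)`: the least imaginary part of `κ ∈ KAd b₁ b₂` with `Re κ = α`, and `+∞` if there is no
such `κ`. -/
noncomputable def I (b₁ b₂ α : ℝ) : EReal :=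
  sInf {t : EReal | ∃ κ ∈ KAd b₁ b₂, κ.re = α ∧ t = (κ.im : EReal)}

/-- `B` is an optimal structure for the frequency `α`: it is admissible, `I(α)` is a (finite)
real number `β`, and `α + i β` is a quasi-eigenvalue of `B`. -/
def IsOptimal (b₁ b₂ α : ℝ) (B : LInf01) : Prop :=
  B ∈ Ad b₁ b₂ ∧ ∃ β : ℝ, I b₁ b₂ α = (β : EReal) ∧ (α : ℂ) + Complex.I * (β : ℂ) ∈ K B

/-- The set of extreme points of the admissible family. -/
def Ext (b₁ b₂ : ℝ) : Set LInf01 := (Ad b₁ b₂).extremePoints ℝ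

/-- The level set `{x ∈ [0,1] : B(x) = b}` (of a representative of `B`). -/
def levelSet (B : LInf01) (b : ℝ) : Set ℝ := {x ∈ Icc (0 : ℝ) 1 | B x = b}

/-- Up to a null subset of `(0,1)`, the set `E` is a union of finitely many intervals (possibly
none; `OrdConnected` subsets of `ℝ` are exactly the intervals of all kinds). -/
def IsFiniteUnionOfIntervals (E : Set ℝ) : Prop :=
  ∃ S : Set (Set ℝ), S.Finite ∧ (∀ J ∈ S, J.OrdConnected) ∧ E =ᵐ[vol01] ⋃₀ S

/-- The extreme points `B` for which both sets `{B = b₁}` and `{B = b₂}` are, up to null sets,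
finite unions of intervals. -/
def ExtS (b₁ b₂ : ℝ) : Set LInf01 :=
  {B ∈ Ext b₁ b₂ | IsFiniteUnionOfIntervals (levelSet B b₁) ∧
    IsFiniteUnionOfIntervals (levelSet B b₂)}

/-- `f` is piecewise constant on `[0,1]`: there is a partition
`0 = p₀ < p₁ < ⋯ < pₙ < pₙ₊₁ = 1` such that `f` is constant on each open interval of it. -/
def IsPiecewiseConstant (f : ℝ → ℝ) : Prop :=
  ∃ (n : ℕ) (p : Fin (n + 2) → ℝ), StrictMono p ∧ p 0 = 0 ∧ p (Fin.last (n + 1)) = 1 ∧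
    ∀ i : Fin (n + 1), ∃ c : ℝ, ∀ x ∈ Ioo (p i.castSucc) (p i.succ), f x = c

end QuasiEig

namespace QuasiEig

open scoped Topology NNReal ComplexConjugate BoundedContinuousFunction

/-! Let `y` be the mode of an optimal `B` at `κ = α + iβ`, normalised by `y(0) = 1`. To first order,
a change `U` of the coefficient acts on the quasi-eigenvalue through the functional `∫ U y²`.

Suppose `α ≠ 0`. If the numbers `∫ (a - B) y²`, with `a` admissible, filled a neighbourhood of `0`,
an implicit function argument would produce an admissible coefficient with quasi-eigenvalue `κ -
it`, `t > 0`, against minimality (`exists_perturbed_eigenvalue`, `exists_lower_mode`). The argument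
moves the coefficient while prescribing `κ - it`, so simplicity of `κ` is never needed. Hence these
numbers, which form a convex set, lie in a half plane `Re (c z) ≤ 0`. So `B` maximises the linear
functional `a ↦ Re (c ∫ a y²)`, which forces `B = b₂` where `Re (c y²) > 0` and `B = b₁` where it is
negative (`bang_bang`).

It remains to see that `Re (c y²)` has finitely many zeros where it matters. By
`IsMode.im_deriv_mul_conj`, `Im (y' ȳ)` is a nonzero multiple of `∫₀ˣ B |y|²`, so the argument of
`y` turns strictly in one direction as soon as that integral is positive. Before that point `y = 1`
and `B = b₁ = 0` a.e. This is `QuasiEig.exists_piecewiseConstant`.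

For `α = 0` the mode is real and does not rotate. Instead `ae_eq_of_imaginary_mode` compares it with
the explicit `cosh` solution for the constant coefficient `b₂` and finds `B = b₂` a.e. -/

/-! ### Absolutely continuous functions on `[0,1]`. -/

theorem ae_vol01_iff {p : ℝ → Prop} : (∀ᵐ x ∂vol01, p x) ↔ ∀ᵐ x, x ∈ Ioo (0 : ℝ) 1 → p x :=
  ae_restrict_iff' measurableSet_Ioo

theorem ae_mem_Icc_of_vol01 {p : ℝ → Prop} (h : ∀ᵐ x ∂vol01, p x) :
    ∀ᵐ x, x ∈ Icc (0 : ℝ) 1 → p x := by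
  have h0 : ∀ᵐ x : ℝ, x ≠ 0 := by simp [ae_iff, measure_singleton]
  have h1 : ∀ᵐ x : ℝ, x ≠ 1 := by simp [ae_iff, measure_singleton]
  filter_upwards [ae_vol01_iff.1 h, h0, h1] with x hx h0 h1 hm
  exact hx ⟨lt_of_le_of_ne hm.1 (Ne.symm h0), lt_of_le_of_ne hm.2 h1⟩

/-- Postcomposition with a Lipschitz map preserves absolute continuity. -/
theorem ac_lipschitz_comp {X Y : Type*} [PseudoMetricSpace X] [PseudoMetricSpace Y]
    {f : ℝ → X} {φ : X → Y} {C : ℝ≥0} {a b : ℝ} (hφ : LipschitzWith C φ)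
    (hf : AbsolutelyContinuousOnInterval f a b) :
    AbsolutelyContinuousOnInterval (fun x => φ (f x)) a b := by
  unfold AbsolutelyContinuousOnInterval at hf
  refine squeeze_zero (fun t => ?_) (fun t => ?_) (by simpa using hf.const_mul (C : ℝ))
  · exact Finset.sum_nonneg fun i _ => dist_nonneg
  · rw [Finset.mul_sum]
    exact Finset.sum_le_sum fun i _ => hφ.dist_le_mul _ _

/-- A real absolutely continuous function with nonnegative derivative a.e. is monotone. -/
theorem ac_monotoneOn {f : ℝ → ℝ} (hf : AbsolutelyContinuousOnInterval f 0 1)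
    (hd : ∀ᵐ x ∂vol01, ∃ d : ℝ, 0 ≤ d ∧ HasDerivAt f d x) : MonotoneOn f (Icc 0 1) := by
  intro a ha b hb hab
  have hsub : uIcc a b ⊆ uIcc (0 : ℝ) 1 := by
    rw [uIcc_of_le hab, uIcc_of_le zero_le_one]
    exact Icc_subset_Icc ha.1 hb.2
  have h := (hf.mono hsub).integral_deriv_eq_sub
  have hnn : 0 ≤ ∫ x in a..b, deriv f x := by
    refine intervalIntegral.integral_nonneg_of_ae_restrict hab ?_
    rw [Filter.EventuallyLE, ae_restrict_iff' measurableSet_Icc]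
    filter_upwards [ae_mem_Icc_of_vol01 hd] with x hx hm
    obtain ⟨d, hd0, hd⟩ := hx ⟨ha.1.trans hm.1, hm.2.trans hb.2⟩
    simpa [hd.deriv] using hd0
  linarith

/-- A primitive of a bounded function is Lipschitz, hence absolutely continuous. -/
theorem ac_primitive {E : Type*} [NormedAddCommGroup E] [NormedSpace ℝ E]
    {g : ℝ → E} {M : ℝ} (hM : ∀ᵐ x ∂vol01, ‖g x‖ ≤ M)
    (hg : IntervalIntegrable g volume 0 1) :
    AbsolutelyContinuousOnInterval (fun x => ∫ s in (0 : ℝ)..x, g s) 0 1 := by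
  refine LipschitzOnWith.absolutelyContinuousOnInterval (K := M.toNNReal) ?_
  rw [uIcc_of_le zero_le_one]
  refine LipschitzOnWith.of_dist_le_mul fun x hx y hy => ?_
  have hi : ∀ z ∈ Icc (0 : ℝ) 1, IntervalIntegrable g volume 0 z := fun z hz =>
    hg.mono_set (by rw [uIcc_of_le hz.1, uIcc_of_le zero_le_one]; exact Icc_subset_Icc_right hz.2)
  rw [dist_eq_norm, intervalIntegral.integral_interval_sub_left (hi x hx) (hi y hy)]
  have hMM : M ≤ (M.toNNReal : ℝ) := Real.le_coe_toNNReal M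
  rw [Real.dist_eq]
  refine intervalIntegral.norm_integral_le_of_norm_le_const_ae ?_
  filter_upwards [ae_mem_Icc_of_vol01 hM] with z hz hm
  refine (hz ?_).trans hMM
  have : uIcc y x ⊆ Icc 0 1 := by
    rw [← uIcc_of_le (zero_le_one (α := ℝ))]
    apply uIcc_subset_uIcc <;> rwa [uIcc_of_le zero_le_one]
  exact this (uIoc_subset_uIcc hm)

theorem intervalIntegrable_of_bound {E : Type*} [NormedAddCommGroup E]
    {g : ℝ → E} {M : ℝ} (hM : ∀ᵐ x ∂vol01, ‖g x‖ ≤ M) (hg : AEStronglyMeasurable g vol01) :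
    IntervalIntegrable g volume 0 1 := by
  rw [intervalIntegrable_iff_integrableOn_Ioo_of_le zero_le_one]
  exact Integrable.of_bound hg M hM

/-- The fundamental theorem of calculus for absolutely continuous functions whose derivative is
bounded. -/
theorem ac_sub_eq_integral {E : Type*} [NormedAddCommGroup E] [NormedSpace ℝ E] [CompleteSpace E]
    {f g : ℝ → E} {M : ℝ} (hf : AbsolutelyContinuousOnInterval f 0 1)
    (hg : AEStronglyMeasurable g vol01) (hM : ∀ᵐ x ∂vol01, ‖g x‖ ≤ M)
    (hd : ∀ᵐ x ∂vol01, HasDerivAt f (g x) x) {x : ℝ} (hx : x ∈ Icc (0 : ℝ) 1) :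
    f x - f 0 = ∫ s in (0 : ℝ)..x, g s := by
  have hi := intervalIntegrable_of_bound hM hg
  have h1 := ac_primitive hM hi
  -- Subtracting the primitive of `g` leaves an absolutely continuous function with zero derivative
  -- a.e., hence a constant.
  obtain ⟨C, hC⟩ := (hf.fun_sub h1).const_of_ae_hasDerivAt_zero (by
    filter_upwards [ae_mem_Icc_of_vol01 hd, hi.ae_hasDerivAt_integral] with z hz hz' hm
    have hm' : z ∈ Icc (0 : ℝ) 1 := by rwa [uIcc_of_le zero_le_one] at hm
    have h2 := (hz hm').sub (hz' hm 0 (by simp))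
    rw [sub_self] at h2
    exact h2)
  have e0 := hC 0 (by simp)
  have e1 := hC x (by rwa [uIcc_of_le zero_le_one])
  simp only [intervalIntegral.integral_same, sub_zero] at e0
  rw [e0, ← e1]
  abel

/-! ### Carathéodory solutions: Wronskian identity and uniqueness. -/

/-- `y` is a Carathéodory solution, with derivative `v`, of `y'' + k b y = 0` on `[0,1]`. -/
structure IsODE (k : ℂ) (b : ℝ → ℝ) (y v : ℝ → ℂ) : Prop where
  hasDeriv : ∀ x ∈ Icc (0 : ℝ) 1, HasDerivWithinAt y (v x) (Icc 0 1) x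
  absCont : AbsolutelyContinuousOnInterval v 0 1
  equation : ∀ᵐ x ∂vol01, HasDerivAt v (-(k * (b x : ℂ) * y x)) x

namespace IsODE

variable {k k' : ℂ} {b b' : ℝ → ℝ} {y v z w : ℝ → ℂ}

theorem continuousOn (h : IsODE k b y v) : ContinuousOn y (Icc 0 1) :=
  fun x hx => (h.hasDeriv x hx).continuousWithinAt

theorem hasDerivAt (h : IsODE k b y v) {x : ℝ} (hx : x ∈ Ioo (0 : ℝ) 1) :
    HasDerivAt y (v x) x :=
  (h.hasDeriv x (Ioo_subset_Icc_self hx)).hasDerivAt (Icc_mem_nhds hx.1 hx.2)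

theorem ae_hasDerivAt (h : IsODE k b y v) : ∀ᵐ x ∂vol01, HasDerivAt y (v x) x :=
  ae_vol01_iff.2 (Filter.Eventually.of_forall fun _ hx => h.hasDerivAt hx)

theorem ac (h : IsODE k b y v) : AbsolutelyContinuousOnInterval y 0 1 := by
  obtain ⟨C, hC⟩ := h.absCont.exists_bound
  rw [uIcc_of_le zero_le_one] at hC
  refine LipschitzOnWith.absolutelyContinuousOnInterval (K := C.toNNReal) ?_
  rw [uIcc_of_le zero_le_one]
  refine (convex_Icc (0 : ℝ) 1).lipschitzOnWith_of_nnnorm_hasDerivWithin_le h.hasDeriv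
    fun x hx => ?_
  rw [← NNReal.coe_le_coe]
  exact (hC x hx).trans (Real.le_coe_toNNReal C)

theorem lincomb (h : IsODE k b y v) (h' : IsODE k b z w) (c c' : ℂ) :
    IsODE k b (fun x => c * y x + c' * z x) (fun x => c * v x + c' * w x) where
  hasDeriv x hx := ((h.hasDeriv x hx).const_mul c).add ((h'.hasDeriv x hx).const_mul c')
  absCont := (h.absCont.const_smul c).fun_add (h'.absCont.const_smul c')
  equation := by
    filter_upwards [h.equation, h'.equation] with x hx hx'
    convert! (hx.const_mul c).add (hx'.const_mul c') using 1
    ring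

theorem conjugate (h : IsODE k b y v) :
    IsODE (conj k) b (fun x => conj (y x)) (fun x => conj (v x)) where
  hasDeriv x hx := (h.hasDeriv x hx).star
  absCont := ac_lipschitz_comp (Complex.isometry_conj.lipschitz) h.absCont
  equation := by
    filter_upwards [h.equation] with x hx
    simpa using hx.star

theorem aestronglyMeasurable (h : IsODE k b y v) : AEStronglyMeasurable y vol01 :=
  (h.continuousOn.mono Ioo_subset_Icc_self).aestronglyMeasurable measurableSet_Ioo

theorem exists_bound (h : IsODE k b y v) : ∃ C, ∀ x ∈ Icc (0 : ℝ) 1, ‖y x‖ ≤ C :=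
  isCompact_Icc.exists_bound_of_continuousOn h.continuousOn

/-- The Lagrange (Wronskian) identity. -/
theorem wronskian (h : IsODE k b y v) (h' : IsODE k' b' z w) (hb : Measurable b)
    (hb' : Measurable b') {M : ℝ} (hM : ∀ x, |b x| ≤ M) (hM' : ∀ x, |b' x| ≤ M) {x : ℝ}
    (hx : x ∈ Icc (0 : ℝ) 1) :
    (y x * w x - v x * z x) - (y 0 * w 0 - v 0 * z 0)
      = ∫ s in (0 : ℝ)..x, (k * b s - k' * b' s) * (y s * z s) := by
  obtain ⟨C, hC⟩ := h.exists_bound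
  obtain ⟨C', hC'⟩ := h'.exists_bound
  refine ac_sub_eq_integral (f := fun x => y x * w x - v x * z x)
    (M := (‖k‖ * M + ‖k'‖ * M) * (C * C')) ?_ ?_ ?_ ?_ hx
  · exact (h.ac.smul h'.absCont).fun_sub (h.absCont.smul h'.ac)
  · refine AEStronglyMeasurable.mul ?_ (h.aestronglyMeasurable.mul h'.aestronglyMeasurable)
    exact (by fun_prop : Measurable fun s => k * (b s : ℂ) - k' * (b' s : ℂ)).aestronglyMeasurable
  · refine ae_vol01_iff.2 (Filter.Eventually.of_forall fun s hs => ?_)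
    have hs' := Ioo_subset_Icc_self hs
    rw [norm_mul, norm_mul]
    have h1 := hC s hs'
    have h2 := hC' s hs'
    have h3 : ‖k * (b s : ℂ) - k' * (b' s : ℂ)‖ ≤ ‖k‖ * M + ‖k'‖ * M := by
      refine (norm_sub_le _ _).trans ?_
      rw [norm_mul, norm_mul, Complex.norm_real, Complex.norm_real]
      exact add_le_add (mul_le_mul_of_nonneg_left (hM s) (norm_nonneg _))
        (mul_le_mul_of_nonneg_left (hM' s) (norm_nonneg _))
    gcongr
    · exact (norm_nonneg _).trans h3
    · exact (norm_nonneg _).trans h1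
  · filter_upwards [h.equation, h'.equation, h.ae_hasDerivAt, h'.ae_hasDerivAt]
      with s h1 h2 h3 h4
    convert! (h3.mul h2).sub (h1.mul h4) using 1
    ring

theorem normSq_ac (hf : AbsolutelyContinuousOnInterval y 0 1) :
    AbsolutelyContinuousOnInterval (fun x => ‖y x‖ ^ 2) 0 1 := by
  have h1 : AbsolutelyContinuousOnInterval (fun x => ‖y x‖) 0 1 :=
    ac_lipschitz_comp lipschitzWith_one_norm hf
  simpa [pow_two] using h1.fun_mul h1

/-- A solution with vanishing Cauchy data at one point vanishes identically. -/
theorem eq_zero (h : IsODE k b y v) {M : ℝ} (hM : ∀ x, |b x| ≤ M) {x₀ : ℝ}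
    (hx₀ : x₀ ∈ Icc (0 : ℝ) 1) (hy : y x₀ = 0) (hv : v x₀ = 0) :
    ∀ x ∈ Icc (0 : ℝ) 1, y x = 0 ∧ v x = 0 := by
  set f : ℝ → ℝ := fun x => ‖y x‖ ^ 2 + ‖v x‖ ^ 2 with hfdef
  have hfac : AbsolutelyContinuousOnInterval f 0 1 :=
    (normSq_ac h.ac).fun_add (normSq_ac h.absCont)
  set L : ℝ := 1 + ‖k‖ * M
  have hf' : ∀ᵐ x ∂vol01, ∃ d : ℝ, |d| ≤ L * f x ∧ HasDerivAt f d x := by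
    filter_upwards [h.equation, h.ae_hasDerivAt] with x h1 h2
    refine ⟨_, ?_, h2.norm_sq.add h1.norm_sq⟩
    have e1 := abs_real_inner_le_norm (y x) (v x)
    have e2 := abs_real_inner_le_norm (v x) (-(k * (b x : ℂ) * y x))
    have e3 : ‖-(k * (b x : ℂ) * y x)‖ ≤ ‖k‖ * M * ‖y x‖ := by
      rw [norm_neg, norm_mul, norm_mul, Complex.norm_real]
      gcongr
      exact hM x
    have hM0 : 0 ≤ ‖k‖ * M := mul_nonneg (norm_nonneg _) ((abs_nonneg _).trans (hM 0))
    calc _ ≤ 2 * (‖y x‖ * ‖v x‖) + 2 * (‖v x‖ * (‖k‖ * M * ‖y x‖)) := by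
          refine (abs_add_le _ _).trans ?_
          rw [abs_mul, abs_mul, abs_two]
          gcongr
          exact e2.trans (mul_le_mul_of_nonneg_left e3 (norm_nonneg _))
      _ = L * (2 * ‖y x‖ * ‖v x‖) := by simp only [L]; ring
      _ ≤ L * f x := by
          gcongr
          exact two_mul_le_add_sq _ _
  -- Grönwall in both directions from `|f'| ≤ L f`: `ε = 1` makes `f e^{Lx}` increasing and controls
  -- points left of `x₀`; `ε = -1` makes `f e^{-Lx}` decreasing and controls those to the right.
  have key : ∀ ε : ℝ, |ε| = 1 →
      MonotoneOn (fun x => ε * (f x * Real.exp (ε * L * x))) (Icc 0 1) := by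
    intro ε hε
    have hee : ε * ε = 1 := by rw [← abs_mul_abs_self, hε, one_mul]
    refine ac_monotoneOn ((hfac.fun_mul ?_).const_mul ε) ?_
    · exact ContDiffOn.absolutelyContinuousOnInterval (by fun_prop)
    · filter_upwards [hf'] with x hx
      obtain ⟨d, hd, hd'⟩ := hx
      have h1 : HasDerivAt (fun x => Real.exp (ε * L * x)) (Real.exp (ε * L * x) * (ε * L)) x := by
        simpa using ((hasDerivAt_id x).const_mul (ε * L)).exp
      refine ⟨_, ?_, (hd'.mul h1).const_mul ε⟩
      have h2 : -(ε * d) ≤ L * f x := by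
        refine (neg_le_abs _).trans ?_
        rwa [abs_mul, hε, one_mul]
      have : ε * (d * Real.exp (ε * L * x) + f x * (Real.exp (ε * L * x) * (ε * L)))
          = Real.exp (ε * L * x) * (ε * d + ε * ε * (L * f x)) := by ring
      rw [this, hee]
      exact mul_nonneg (Real.exp_pos _).le (by linarith)
  have hf0 : f x₀ = 0 := by simp [hfdef, hy, hv]
  intro x hx
  have hfx : f x ≤ 0 := by
    rcases le_total x x₀ with hle | hle
    · have := key 1 (by simp) hx hx₀ hle
      simp only [hf0, one_mul, zero_mul] at this
      exact nonpos_of_mul_nonpos_left this (Real.exp_pos _)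
    · have := key (-1) (by simp) hx₀ hx hle
      simp only [hf0, zero_mul, mul_zero] at this
      have h3 : f x * Real.exp (-1 * L * x) ≤ 0 := by linarith
      exact nonpos_of_mul_nonpos_left h3 (Real.exp_pos _)
  have h1 := sq_nonneg ‖y x‖
  have h2 := sq_nonneg ‖v x‖
  have e1 : ‖y x‖ ^ 2 = 0 := by simp only [hfdef] at hfx; linarith
  have e2 : ‖v x‖ ^ 2 = 0 := by simp only [hfdef] at hfx; linarith
  exact ⟨by simpa using e1, by simpa using e2⟩

end IsODE

/-! ### Weighted Volterra operators. -/

/-- The nearest point retraction of `ℝ` onto `[0,1]`. -/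
noncomputable def clamp (x : ℝ) : ℝ := max 0 (min 1 x)

theorem clamp_mem (x : ℝ) : clamp x ∈ Icc (0 : ℝ) 1 :=
  ⟨le_max_left _ _, max_le zero_le_one (min_le_left _ _)⟩

theorem clamp_of_mem {x : ℝ} (hx : x ∈ Icc (0 : ℝ) 1) : clamp x = x := by
  simp [clamp, hx.1, hx.2]

theorem continuous_clamp : Continuous clamp := by unfold clamp; fun_prop

/-- The factor `1 / l` is what the exponential weight gains: for `l` large the Volterra operators
have small norm, and no iteration is needed to invert `1 + k J₁ J_b`. -/
theorem exp_mul_integral_exp {l : ℝ} (hl : 0 < l) (x : ℝ) :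
    Real.exp (-(l * x)) * ∫ s in (0 : ℝ)..x, Real.exp (l * s) ≤ 1 / l := by
  have h : ∫ s in (0 : ℝ)..x, Real.exp (l * s) = (Real.exp (l * x) - 1) / l := by
    rw [intervalIntegral.integral_comp_mul_left (fun s => Real.exp s) hl.ne']
    simp [integral_exp]
    field_simp
  rw [h, mul_div_assoc', mul_sub, ← Real.exp_add]
  simp only [neg_add_cancel, Real.exp_zero, mul_one]
  gcongr
  linarith [Real.exp_pos (-(l * x))]

theorem intervalIntegrable_weight (l : ℝ) {h : ℝ → ℂ} (hh : Measurable h) {M : ℝ}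
    (hM : ∀ x, ‖h x‖ ≤ M) (f : ℝ →ᵇ ℂ) (a b : ℝ) :
    IntervalIntegrable (fun s => (Real.exp (l * s) : ℂ) * (h s * f s)) volume a b := by
  have h1 : IntervalIntegrable (fun s => h s * ((Real.exp (l * s) : ℂ) * f s)) volume a b := by
    refine IntervalIntegrable.mul_continuousOn ?_ (by fun_prop)
    rw [intervalIntegrable_iff]
    exact Measure.integrableOn_of_bounded (by simp) hh.aestronglyMeasurable
      (Filter.Eventually.of_forall hM)
  refine h1.congr (fun s _ => ?_)
  ring

/-- The weighted Volterra operator `f ↦ e^{-lx} ∫₀ˣ e^{ls} h(s) f(s) ds` on `[0,1]`. -/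
theorem exists_volterra {l : ℝ} (hl : 0 < l) {h : ℝ → ℂ} (hh : Measurable h) {M : ℝ}
    (hM : ∀ x, ‖h x‖ ≤ M) :
    ∃ J : (ℝ →ᵇ ℂ) →L[ℂ] (ℝ →ᵇ ℂ), ‖J‖ ≤ M / l ∧ ∀ f : ℝ →ᵇ ℂ, ∀ x ∈ Icc (0 : ℝ) 1,
      J f x = (Real.exp (-(l * x)) : ℂ) *
        ∫ s in (0 : ℝ)..x, (Real.exp (l * s) : ℂ) * (h s * f s) := by
  have hM0 : 0 ≤ M := (norm_nonneg _).trans (hM 0)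
  set F : (ℝ →ᵇ ℂ) → ℝ → ℂ := fun f x => (Real.exp (-(l * x)) : ℂ) *
        ∫ s in (0 : ℝ)..x, (Real.exp (l * s) : ℂ) * (h s * f s) with hF
  have hcont : ∀ f, Continuous (F f) := fun f => by
    have := intervalIntegral.continuous_primitive (intervalIntegrable_weight l hh hM f) 0
    fun_prop
  have hbd : ∀ f, ∀ x ∈ Icc (0 : ℝ) 1, ‖F f x‖ ≤ M / l * ‖f‖ := fun f x hx => by
    have h1 : ‖∫ s in (0 : ℝ)..x, (Real.exp (l * s) : ℂ) * (h s * f s)‖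
        ≤ ∫ s in (0 : ℝ)..x, Real.exp (l * s) * (M * ‖f‖) := by
      refine intervalIntegral.norm_integral_le_of_norm_le hx.1 ?_
        (Continuous.intervalIntegrable (by fun_prop) _ _)
      refine Filter.Eventually.of_forall fun s _ => ?_
      rw [norm_mul, norm_mul, Complex.norm_real, Real.norm_of_nonneg (Real.exp_pos _).le]
      gcongr
      · exact hM s
      · exact f.norm_coe_le_norm s
    rw [intervalIntegral.integral_mul_const] at h1
    calc ‖F f x‖ ≤ Real.exp (-(l * x)) * ((∫ s in (0 : ℝ)..x, Real.exp (l * s)) * (M * ‖f‖)) := by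
          rw [hF, norm_mul, Complex.norm_real, Real.norm_of_nonneg (Real.exp_pos _).le]
          gcongr
      _ ≤ 1 / l * (M * ‖f‖) := by
          rw [← mul_assoc]
          gcongr
          exact exp_mul_integral_exp hl x
      _ = M / l * ‖f‖ := by ring
  have hadd : ∀ f g x, F (f + g) x = F f x + F g x := fun f g x => by
    simp only [hF]
    rw [← mul_add, ← intervalIntegral.integral_add (intervalIntegrable_weight l hh hM f _ _)
      (intervalIntegrable_weight l hh hM g _ _)]
    congr 2
    ext s
    simp only [BoundedContinuousFunction.coe_add, Pi.add_apply]
    ring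
  have hsmul : ∀ (c : ℂ) f x, F (c • f) x = c * F f x := fun c f x => by
    simp only [hF, ← intervalIntegral.integral_const_mul]
    refine intervalIntegral.integral_congr fun s _ => ?_
    simp only [BoundedContinuousFunction.coe_smul, smul_eq_mul]
    ring
  -- Composing with `clamp` extends functions on `[0,1]` to bounded continuous functions on `ℝ`;
  -- only their values on `[0,1]` are used later.
  refine ⟨LinearMap.mkContinuous
    { toFun := fun f => BoundedContinuousFunction.ofNormedAddCommGroup
        (fun x => F f (clamp x)) ((hcont f).comp continuous_clamp) (M / l * ‖f‖)
        (fun x => hbd f _ (clamp_mem x))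
      map_add' := fun f g => by ext x; simp [hadd]
      map_smul' := fun c f => by ext x; simp [hsmul] } (M / l) (fun f => ?_), ?_, ?_⟩
  · exact BoundedContinuousFunction.norm_ofNormedAddCommGroup_le _ (by positivity)
      (fun x => hbd f _ (clamp_mem x))
  · exact LinearMap.mkContinuous_norm_le _ (by positivity) _
  · intro f x hx
    simp [hF, clamp_of_mem hx]

/-- Solving `z̃ + k J₁ J_b z̃ = e^{-lx}` for the weighted Volterra operators yields a solution of
the initial value problem `y'' + k b y = 0`, `y(0) = 1`, `y'(0) = 0`. -/
theorem isODE_of_volterra {l : ℝ} {b : ℝ → ℝ} (hb : Measurable b) {M : ℝ}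
    (hM : ∀ x, |b x| ≤ M) {k : ℂ} {z u : ℝ →ᵇ ℂ}
    (hu : ∀ x ∈ Icc (0 : ℝ) 1, u x = (Real.exp (-(l * x)) : ℂ) *
      ∫ s in (0 : ℝ)..x, (Real.exp (l * s) : ℂ) * ((b s : ℂ) * z s))
    (hz : ∀ x ∈ Icc (0 : ℝ) 1, z x + k * ((Real.exp (-(l * x)) : ℂ) *
      ∫ s in (0 : ℝ)..x, (Real.exp (l * s) : ℂ) * (1 * u s)) = (Real.exp (-(l * x)) : ℂ)) :
    ∃ v : ℝ → ℂ, IsODE k b (fun x => (Real.exp (l * x) : ℂ) * z x) v ∧ v 0 = 0 ∧ z 0 = 1 := by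
  have hbC : Measurable fun s => (b s : ℂ) := by fun_prop
  have hbM : ∀ x, ‖(b x : ℂ)‖ ≤ M := fun x => by simpa using hM x
  have hexp : ∀ x : ℝ, (Real.exp (l * x) : ℂ) * (Real.exp (-(l * x)) : ℂ) = 1 := fun x => by
    rw [← Complex.ofReal_mul, ← Real.exp_add]; simp
  -- Undoing the weight, `y = e^{lx} z` satisfies `y = 1 + ∫ v` with `v = -k ∫ b y`.
  set v : ℝ → ℂ := fun x =>
    -k * ∫ s in (0 : ℝ)..x, (Real.exp (l * s) : ℂ) * ((b s : ℂ) * z s) with hv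
  have hvu : ∀ x ∈ Icc (0 : ℝ) 1, v x = -k * ((Real.exp (l * x) : ℂ) * (1 * u x)) := fun x hx => by
    simp only [hv]
    rw [hu x hx, one_mul, ← mul_assoc (Real.exp (l * x) : ℂ), hexp, one_mul]
  have hcont : Continuous fun x => (Real.exp (l * x) : ℂ) * (1 * u x) := by fun_prop
  have hzy : ∀ x ∈ Icc (0 : ℝ) 1, (Real.exp (l * x) : ℂ) * z x
      = 1 + -k * ∫ s in (0 : ℝ)..x, (Real.exp (l * s) : ℂ) * (1 * u s) := fun x hx => by
    rw [eq_sub_of_add_eq (hz x hx), mul_sub, hexp]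
    linear_combination (-k * ∫ s in (0 : ℝ)..x, (Real.exp (l * s) : ℂ) * (1 * u s)) * hexp x
  have hint := fun a c => intervalIntegrable_weight l hbC hbM z a c
  refine ⟨v, ⟨fun x hx => ?_, ?_, ?_⟩, by simp [hv], ?_⟩
  · have h1 : HasDerivAt (fun x => 1 + -k * ∫ s in (0 : ℝ)..x, (Real.exp (l * s) : ℂ) * (1 * u s))
        (-k * ((Real.exp (l * x) : ℂ) * (1 * u x))) x :=
      ((hcont.integral_hasStrictDerivAt 0 x).hasDerivAt.const_mul (-k)).const_add 1
    rw [hvu x hx]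
    exact h1.hasDerivWithinAt.congr hzy (hzy x hx)
  · refine AbsolutelyContinuousOnInterval.const_smul (-k) ?_
    refine ac_primitive (M := Real.exp |l| * (M * ‖z‖)) ?_ (hint 0 1)
    refine ae_vol01_iff.2 (Filter.Eventually.of_forall fun s hs => ?_)
    have hM0 : 0 ≤ M := (abs_nonneg _).trans (hM 0)
    rw [norm_mul, norm_mul, Complex.norm_real, Real.norm_of_nonneg (Real.exp_pos _).le]
    gcongr
    · calc l * s ≤ |l| * s := mul_le_mul_of_nonneg_right (le_abs_self l) hs.1.le
        _ ≤ |l| * 1 := mul_le_mul_of_nonneg_left hs.2.le (abs_nonneg l)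
        _ = |l| := mul_one _
    · exact hbM s
    · exact z.norm_coe_le_norm s
  · refine ae_vol01_iff.2 ?_
    filter_upwards [(hint 0 1).ae_hasDerivAt_integral] with x hx hm
    have hm' : x ∈ uIcc (0 : ℝ) 1 := by
      rw [uIcc_of_le zero_le_one]; exact Ioo_subset_Icc_self hm
    convert! (hx hm' 0 (by simp)).const_mul (-k) using 1
    ring
  · simpa using hz 0 (by simp)

/-! ### Implicit function argument and smooth dependence on parameters. -/

/-- An implicit function lemma: if `G` is `C¹` near `0`, `G 0 = 0`, and its derivative in the
direction `(0,a,w)` is `c w`, `c ≠ 0`, then `G (t, D t, w) = 0` has solutions with `t → 0+` and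
`|w| ≤ C t`, where `C` does not depend on `D`. -/
theorem exists_zero_curve {G : ℝ × ℝ × ℂ → ℂ} (hG : ContDiffAt ℝ 1 G 0) (hG0 : G 0 = 0) {c : ℂ}
    (hc : c ≠ 0)
    (hd : ∀ (a : ℝ) (w : ℂ), HasDerivAt (fun s : ℝ => G (s • ((0 : ℝ), a, w))) (c * w) 0) :
    ∃ C : ℝ, 0 < C ∧ ∀ D : ℝ, ∀ P : ℝ × ℝ × ℂ → Prop, (∀ᶠ p in 𝓝 0, P p) →
      ∃ (t : ℝ) (w : ℂ), 0 < t ∧ ‖w‖ ≤ C * t ∧ P (t, D * t, w) ∧ G (t, D * t, w) = 0 := by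
  have hs := hG.hasStrictFDerivAt (by norm_num)
  set L := fderiv ℝ G 0
  have hL : ∀ (a : ℝ) (w : ℂ), L (0, a, w) = c * w := fun a w => by
    have h1 : HasDerivAt (fun s : ℝ => s • ((0 : ℝ), a, w)) ((0 : ℝ), a, w) 0 := by
      simpa using (hasDerivAt_id (0 : ℝ)).smul_const ((0 : ℝ), a, w)
    have h2 : HasFDerivAt G L ((0 : ℝ) • ((0 : ℝ), a, w)) := by
      rw [zero_smul]; exact hs.hasFDerivAt
    exact (h2.comp_hasDerivAt (0 : ℝ) h1).unique (hd a w)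
  set c₀ := L (1, 0, 0)
  have hLt : ∀ (t a : ℝ) (w : ℂ), L (t, a, w) = t * c₀ + c * w := fun t a w => by
    have : (t, a, w) = t • ((1 : ℝ), (0 : ℝ), (0 : ℂ)) + ((0 : ℝ), a, w) := by simp
    rw [this, map_add, map_smul, hL]
    simp [c₀]
  have hcpos : 0 < ‖c‖ := norm_pos_iff.2 hc
  -- `D` does not enter the constant because `L` vanishes on the second coordinate: on a zero of `G`
  -- only `t c₀ + c w` has to be small.
  refine ⟨2 * (‖c₀‖ + 1) / ‖c‖, by positivity, fun D P hP => ?_⟩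
  let A : ℝ × ℂ →L[ℝ] ℝ × ℝ × ℂ := (ContinuousLinearMap.fst ℝ ℝ ℂ).prod
    ((D • ContinuousLinearMap.fst ℝ ℝ ℂ).prod (ContinuousLinearMap.snd ℝ ℝ ℂ))
  have hA : ∀ p : ℝ × ℂ, A p = (p.1, D * p.1, p.2) := fun p => by simp [A]
  have hA0 : Filter.Tendsto A (𝓝 0) (𝓝 0) := by
    simpa using A.continuous.tendsto 0
  have hsA : HasStrictFDerivAt (fun p => G (A p)) (L.comp A) 0 := by
    have hs' : HasStrictFDerivAt G L (A 0) := by rwa [map_zero]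
    exact hs'.comp 0 A.hasStrictFDerivAt
  -- Keeping `t` as a first component turns the problem into hitting `(t, 0)`; the derivative of `H`
  -- is onto because `c ≠ 0`, so `H` is locally open.
  let H : ℝ × ℂ → ℝ × ℂ := fun p => (p.1, G (A p))
  have hH : HasStrictFDerivAt H ((ContinuousLinearMap.fst ℝ ℝ ℂ).prod (L.comp A)) 0 :=
    (ContinuousLinearMap.hasStrictFDerivAt (ContinuousLinearMap.fst ℝ ℝ ℂ)).prodMk hsA
  have hsurj : ((ContinuousLinearMap.fst ℝ ℝ ℂ).prod (L.comp A)).range = ⊤ := by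
    refine LinearMap.range_eq_top.2 fun p => ⟨(p.1, (p.2 - p.1 * c₀) / c), ?_⟩
    ext1
    · simp
    · simp only [ContinuousLinearMap.coe_coe, ContinuousLinearMap.prod_apply,
        ContinuousLinearMap.coe_comp, Function.comp_apply, hA, hLt]
      field_simp
      ring
  have hmap := hH.map_nhds_eq_of_surj hsurj
  have hH0 : H 0 = 0 := by simp [H, hG0]
  rw [hH0] at hmap
  -- The first bound lets the `‖w‖` part of the linearisation error be absorbed in `‖c‖ ‖w‖`; the
  -- second keeps the part coming from `(t, D t)` below `t`, whatever `D` is.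
  set δ : ℝ := min (‖c‖ / 2) (1 / (1 + |D|)) with hδ
  have hD : 0 < 1 + |D| := by positivity
  have hδpos : 0 < δ := lt_min (by positivity) (by positivity)
  have hev := (hs.hasFDerivAt.isLittleO.def hδpos)
  have hN : ∀ᶠ p : ℝ × ℂ in 𝓝 0, P (A p) ∧ ‖G (A p) - G 0 - L (A p - 0)‖ ≤ δ * ‖A p - 0‖ :=
    (hA0.eventually hP).and (hA0.eventually hev)
  have himg : H '' {p | P (A p) ∧ ‖G (A p) - G 0 - L (A p - 0)‖ ≤ δ * ‖A p - 0‖} ∈ 𝓝 0 := by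
    rw [← hmap]; exact Filter.image_mem_map hN
  have hten : Filter.Tendsto (fun t : ℝ => ((t, 0) : ℝ × ℂ)) (𝓝[>] 0) (𝓝 0) := by
    have : Filter.Tendsto (fun t : ℝ => ((t, 0) : ℝ × ℂ)) (𝓝 0) (𝓝 ((0 : ℝ), (0 : ℂ))) :=
      Continuous.tendsto (by fun_prop) 0
    exact this.mono_left nhdsWithin_le_nhds
  obtain ⟨t, ⟨⟨p, ⟨hp1, hp2⟩, hpH⟩, ht⟩⟩ :=
    ((hten.eventually himg).and self_mem_nhdsWithin).exists
  have ht' : (0 : ℝ) < t := ht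
  have e1 : p.1 = t := congrArg Prod.fst hpH
  have e2 : G (A p) = 0 := congrArg Prod.snd hpH
  rw [e2, hG0, hA, e1, sub_zero, sub_zero, zero_sub, norm_neg, hLt] at hp2
  rw [hA, e1] at e2 hp1
  refine ⟨t, p.2, ht', ?_, hp1, e2⟩
  have hnorm : ‖(t, D * t, p.2)‖ ≤ (1 + |D|) * t + ‖p.2‖ := by
    have h0 := norm_nonneg p.2
    have h1 : 0 ≤ |D| * t := by positivity
    refine max_le ?_ (max_le ?_ ?_)
    · rw [Real.norm_of_nonneg ht'.le]; linarith
    · rw [norm_mul, Real.norm_eq_abs, Real.norm_of_nonneg ht'.le]; linarith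
    · nlinarith
  have h3 : ‖c‖ * ‖p.2‖ ≤ ‖(t : ℂ) * c₀ + c * p.2‖ + t * ‖c₀‖ := by
    have : c * p.2 = ((t : ℂ) * c₀ + c * p.2) - t * c₀ := by ring
    rw [← norm_mul, this]
    refine (norm_sub_le _ _).trans (le_of_eq ?_)
    rw [← this, norm_mul (t : ℂ), Complex.norm_real, Real.norm_of_nonneg ht'.le]
  have h4 : δ * ((1 + |D|) * t) ≤ t := by
    calc δ * ((1 + |D|) * t) ≤ 1 / (1 + |D|) * ((1 + |D|) * t) := by
          gcongr; exact min_le_right _ _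
      _ = t := by field_simp
  have h5 : δ * ‖p.2‖ ≤ ‖c‖ / 2 * ‖p.2‖ := by gcongr; exact min_le_left _ _
  have h6 : δ * ‖(t, D * t, p.2)‖ ≤ δ * ((1 + |D|) * t + ‖p.2‖) := by gcongr
  rw [div_mul_eq_mul_div, le_div_iff₀ hcpos]
  nlinarith

/-- Smooth dependence of `(1 + T p)⁻¹` on a parameter. -/
theorem exists_contDiffAt_right_inverse {P R : Type*} [NormedAddCommGroup P] [NormedSpace ℝ P]
    [NormedRing R] [NormedAlgebra ℂ R] [CompleteSpace R] {T : P → R} (hT : ContDiff ℝ 1 T)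
    (h0 : ‖T 0‖ < 1) :
    ∃ S : P → R, ContDiffAt ℝ 1 S 0 ∧ ∀ᶠ p in 𝓝 0, (1 + T p) * S p = 1 := by
  have hunit0 : IsUnit (1 + T 0) := by
    have h1 : ‖-T 0‖ < 1 := by rwa [norm_neg]
    have := (Units.oneSub _ h1).isUnit
    rwa [Units.val_oneSub, sub_neg_eq_add] at this
  have hOp : ContDiff ℝ 1 fun p => 1 + T p := contDiff_const.add hT
  refine ⟨fun p => Ring.inverse (1 + T p), ?_, ?_⟩
  · obtain ⟨x, hx⟩ := hunit0
    have h2 : ContDiffAt ℝ 1 Ring.inverse (1 + T 0) := by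
      rw [← hx]; exact contDiffAt_ringInverse ℝ x
    exact h2.comp 0 hOp.contDiffAt
  · have := hOp.continuous.continuousAt.eventually (Units.isOpen.mem_nhds hunit0)
    filter_upwards [this] with p hp
    exact Ring.mul_inverse_cancel _ hp

/-- Meant for `T p = k(p) J₁ J_{b(p)}`: smallness is required only at `p = 0`, since invertibility
of `1 + T p` is an open condition. -/
theorem exists_contDiffAt_solution {P E : Type*} [NormedAddCommGroup P] [NormedSpace ℝ P]
    [NormedAddCommGroup E] [NormedSpace ℂ E] [CompleteSpace E] {T : P → E →L[ℂ] E}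
    (hT : ContDiff ℝ 1 T) (h0 : ‖T 0‖ < 1) (e : E) :
    ∃ z : P → E, ContDiffAt ℝ 1 z 0 ∧ ∀ᶠ p in 𝓝 0, z p + T p (z p) = e := by
  obtain ⟨S, hS, hS'⟩ := exists_contDiffAt_right_inverse (R := E →L[ℂ] E) hT h0
  refine ⟨fun p => S p e, ?_, ?_⟩
  · exact ((ContinuousLinearMap.apply ℂ E e).restrictScalars ℝ).contDiff.contDiffAt.comp 0 hS
  · filter_upwards [hS'] with p hp
    exact congrArg (fun T : E →L[ℂ] E => T e) hp

theorem contDiff_comp_clm {P E : Type*} [NormedAddCommGroup P] [NormedSpace ℝ P]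
    [NormedAddCommGroup E] [NormedSpace ℂ E] {J : E →L[ℂ] E} {A : P → E →L[ℂ] E}
    (hA : ContDiff ℝ 1 A) : ContDiff ℝ 1 fun p => J.comp (A p) := 
   (((ContinuousLinearMap.compL ℂ E E E) J).restrictScalars ℝ).contDiff.comp hA

/-! ### Perturbation of a quasi-eigenvalue. -/

/-- Perturbation of a quasi-eigenvalue `κ` of `b`: if the functionals `U ↦ ∫ U y²` take the values
`0`, `1`, `i` at `U₀`, `U₁`, `U₂`, then for small `t > 0` the number `κ - it` is a quasi-eigenvalue
of `b + D t U₀ + (Re w) U₁ + (Im w) U₂` for some `w = O(t)`, uniformly in `D`. -/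
theorem exists_perturbed_eigenvalue {κ : ℂ} (hκ : κ ≠ 0) {b U₀ U₁ U₂ : ℝ → ℝ} {M : ℝ}
    (hb : Measurable b) (hbM : ∀ x, |b x| ≤ M) (hU₀ : Measurable U₀) (hU₀M : ∀ x, |U₀ x| ≤ M)
    (hU₁ : Measurable U₁) (hU₁M : ∀ x, |U₁ x| ≤ M) (hU₂ : Measurable U₂) (hU₂M : ∀ x, |U₂ x| ≤ M)
    {y v : ℝ → ℂ} (h : IsODE (κ ^ 2) b y v) (hv0 : v 0 = 0) (hy0 : y 0 = 1)
    (hv1 : v 1 = -(Complex.I * κ * y 1)) (hy1 : y 1 ≠ 0)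
    (h₀ : ∫ s in (0 : ℝ)..1, (U₀ s : ℂ) * y s ^ 2 = 0)
    (h₁ : ∫ s in (0 : ℝ)..1, (U₁ s : ℂ) * y s ^ 2 = 1)
    (h₂ : ∫ s in (0 : ℝ)..1, (U₂ s : ℂ) * y s ^ 2 = Complex.I) :
    ∃ C : ℝ, 0 < C ∧ ∀ D ε : ℝ, 0 < ε → ∃ (t : ℝ) (w : ℂ), 0 < t ∧ t < ε ∧ ‖w‖ ≤ C * t ∧
      ∃ z u : ℝ → ℂ, IsODE ((κ - Complex.I * t) ^ 2)
        (fun s => b s + D * t * U₀ s + w.re * U₁ s + w.im * U₂ s) z u ∧ u 0 = 0 ∧ z 0 = 1 ∧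
        u 1 = -(Complex.I * (κ - Complex.I * t) * z 1) := by
  have hM0 : 0 ≤ M := (abs_nonneg _).trans (hbM 0)
  -- Large enough that `‖κ² J K_b‖ ≤ ‖κ‖² M / l² < 1`.
  set l : ℝ := ‖κ‖ * (M + 1) + 1 with hl
  have hlpos : 0 < l := by positivity
  have hlM : ‖κ‖ ^ 2 * M < l ^ 2 := by
    have h1 := norm_nonneg κ
    have h2 : 0 ≤ ‖κ‖ * (M + 1) := by positivity
    have h3 : 0 ≤ ‖κ‖ ^ 2 * M := by positivity
    have h4 : 0 ≤ ‖κ‖ ^ 2 * M * M := by positivity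
    have h5 : 0 ≤ ‖κ‖ ^ 2 := by positivity
    nlinarith
  obtain ⟨Cy, hCy⟩ := h.exists_bound
  have hCy0 : 0 ≤ Cy := (norm_nonneg _).trans (hCy 0 (by simp))
  set yc : ℝ → ℂ := fun x => y (clamp x) with hyc
  have hycc : Continuous yc := h.continuousOn.comp_continuous continuous_clamp clamp_mem
  have hcast : ∀ {U : ℝ → ℝ}, (∀ x, |U x| ≤ M) → ∀ x, ‖(U x : ℂ)‖ ≤ M := fun hU x => by
    simpa using hU x
  have hycM : ∀ {U : ℝ → ℝ}, (∀ x, |U x| ≤ M) → ∀ x, ‖(U x : ℂ) * yc x‖ ≤ M * Cy := fun hU x => by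
    rw [norm_mul]
    exact mul_le_mul (hcast hU x) (hCy _ (clamp_mem x)) (norm_nonneg _) hM0
  have hm : ∀ {U : ℝ → ℝ}, Measurable U → Measurable fun s => (U s : ℂ) := fun hU => by fun_prop
  have hmy : ∀ {U : ℝ → ℝ}, Measurable U → Measurable fun s => (U s : ℂ) * yc s := fun hU =>
    (hm hU).mul hycc.measurable
  obtain ⟨J, hJ, hJf⟩ := exists_volterra hlpos (h := fun _ => 1) measurable_const (M := 1)
    (by simp)
  obtain ⟨Kb, hKb, hKbf⟩ := exists_volterra hlpos (hm hb) (hcast hbM)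
  obtain ⟨K₀, -, hK₀f⟩ := exists_volterra hlpos (hm hU₀) (hcast hU₀M)
  obtain ⟨K₁, -, hK₁f⟩ := exists_volterra hlpos (hm hU₁) (hcast hU₁M)
  obtain ⟨K₂, -, hK₂f⟩ := exists_volterra hlpos (hm hU₂) (hcast hU₂M)
  obtain ⟨Λb, -, hΛb⟩ := exists_volterra hlpos (hmy hb) (hycM hbM)
  obtain ⟨Λ₀, -, hΛ₀⟩ := exists_volterra hlpos (hmy hU₀) (hycM hU₀M)
  obtain ⟨Λ₁, -, hΛ₁⟩ := exists_volterra hlpos (hmy hU₁) (hycM hU₁M)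
  obtain ⟨Λ₂, -, hΛ₂⟩ := exists_volterra hlpos (hmy hU₂) (hycM hU₂M)
  let e : ℝ →ᵇ ℂ := BoundedContinuousFunction.ofNormedAddCommGroup
    (fun x => (Real.exp (-(l * clamp x)) : ℂ))
    (by have := continuous_clamp; fun_prop) 1 (fun x => by
      rw [Complex.norm_real, Real.norm_of_nonneg (Real.exp_pos _).le, Real.exp_le_one_iff]
      have := (clamp_mem x).1
      have : 0 ≤ l * clamp x := by positivity
      linarith)
  have he : ∀ x ∈ Icc (0 : ℝ) 1, e x = (Real.exp (-(l * x)) : ℂ) := fun x hx => by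
    simp [e, clamp_of_mem hx]
  let ev : (ℝ →ᵇ ℂ) →L[ℂ] ℂ := BoundedContinuousFunction.evalCLM ℂ (1 : ℝ)
  let A : ℝ × ℝ × ℂ → ((ℝ →ᵇ ℂ) →L[ℂ] (ℝ →ᵇ ℂ)) := fun p =>
    Kb + (p.2.1 : ℂ) • K₀ + (p.2.2.re : ℂ) • K₁ + (p.2.2.im : ℂ) • K₂
  let kt : ℝ × ℝ × ℂ → ℂ := fun p => (κ - Complex.I * p.1) ^ 2
  have hc1 : ContDiff ℝ 1 fun p : ℝ × ℝ × ℂ => (p.1 : ℂ) :=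
    Complex.ofRealCLM.contDiff.comp contDiff_fst
  have hc2 : ContDiff ℝ 1 fun p : ℝ × ℝ × ℂ => (p.2.1 : ℂ) :=
    Complex.ofRealCLM.contDiff.comp (contDiff_fst.comp contDiff_snd)
  have hc3 : ContDiff ℝ 1 fun p : ℝ × ℝ × ℂ => (p.2.2.re : ℂ) :=
    Complex.ofRealCLM.contDiff.comp (Complex.reCLM.contDiff.comp (contDiff_snd.comp contDiff_snd))
  have hc4 : ContDiff ℝ 1 fun p : ℝ × ℝ × ℂ => (p.2.2.im : ℂ) :=
    Complex.ofRealCLM.contDiff.comp (Complex.imCLM.contDiff.comp (contDiff_snd.comp contDiff_snd))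
  have hkt : ContDiff ℝ 1 kt := (contDiff_const.sub (contDiff_const.mul hc1)).pow 2
  have hA : ContDiff ℝ 1 A :=
    ((contDiff_const.add (hc2.smul contDiff_const)).add (hc3.smul contDiff_const)).add
      (hc4.smul contDiff_const)
  have hT : ContDiff ℝ 1 fun p => kt p • J.comp (A p) := hkt.smul (contDiff_comp_clm hA)
  have hkt0 : kt 0 = κ ^ 2 := by simp [kt]
  have hA0 : A 0 = Kb := ContinuousLinearMap.ext fun f => by simp [A]
  have hT0 : ‖kt 0 • J.comp (A 0)‖ < 1 := by
    rw [hkt0, hA0, norm_smul, norm_pow]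
    calc ‖κ‖ ^ 2 * ‖J.comp Kb‖ ≤ ‖κ‖ ^ 2 * (1 / l * (M / l)) := by
          gcongr
          exact (ContinuousLinearMap.opNorm_comp_le _ _).trans
            (mul_le_mul hJ hKb (norm_nonneg _) (by positivity))
      _ = ‖κ‖ ^ 2 * M / l ^ 2 := by field_simp
      _ < 1 := by rwa [div_lt_one (by positivity)]
  obtain ⟨zt, hzt, hev_eq⟩ := exists_contDiffAt_solution hT hT0 e
  -- By the Wronskian identity against the fixed mode `y`, near `0` this is `-e^{-l} y(1) (z'(1) +
  -- i(κ - it) z(1))` for the perturbed solution `z`, so its zeros give the boundary condition at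
  -- `1`.
  let G : ℝ × ℝ × ℂ → ℂ := fun p =>
    kt p * ((p.2.1 : ℂ) * ev (Λ₀ (zt p)) + (p.2.2.re : ℂ) * ev (Λ₁ (zt p))
      + (p.2.2.im : ℂ) * ev (Λ₂ (zt p)))
    - (κ ^ 2 - kt p) * ev (Λb (zt p)) + Complex.I * (Complex.I * p.1) * y 1 * ev (zt p)
  have hlin : ∀ Φ : (ℝ →ᵇ ℂ) →L[ℂ] ℂ, ContDiffAt ℝ 1 (fun p => Φ (zt p)) 0 := fun Φ =>
    (Φ.restrictScalars ℝ).contDiff.contDiffAt.comp 0 hzt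
  have hG : ContDiffAt ℝ 1 G 0 := by
    have g0 := hlin (ev.comp Λ₀)
    have g1 := hlin (ev.comp Λ₁)
    have g2 := hlin (ev.comp Λ₂)
    have g3 := hlin (ev.comp Λb)
    have g4 := hlin ev
    exact ((hkt.contDiffAt.mul (((hc2.contDiffAt.mul g0).add (hc3.contDiffAt.mul g1)).add
      (hc4.contDiffAt.mul g2))).sub ((contDiffAt_const.sub hkt.contDiffAt).mul g3)).add
      (((contDiffAt_const.mul (contDiffAt_const.mul hc1.contDiffAt)).mul contDiffAt_const).mul g4)
  let bp : ℝ × ℝ × ℂ → ℝ → ℝ := fun p s =>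
    b s + p.2.1 * U₀ s + p.2.2.re * U₁ s + p.2.2.im * U₂ s
  have hbp : ∀ p, Measurable (bp p) := fun p => by fun_prop
  have hbpM : ∀ p x, |bp p x| ≤ M * (1 + |p.2.1| + |p.2.2.re| + |p.2.2.im|) := fun p x => by
    have e0 := hbM x
    have e1 : |p.2.1 * U₀ x| ≤ |p.2.1| * M := by rw [abs_mul]; gcongr; exact hU₀M x
    have e2 : |p.2.2.re * U₁ x| ≤ |p.2.2.re| * M := by rw [abs_mul]; gcongr; exact hU₁M x
    have e3 : |p.2.2.im * U₂ x| ≤ |p.2.2.im| * M := by rw [abs_mul]; gcongr; exact hU₂M x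
    refine (abs_add_le _ _).trans ?_
    refine (add_le_add_left ((abs_add_le _ _).trans (add_le_add_left (abs_add_le _ _) _)) _).trans
      ?_
    linarith
  have hii := fun {U : ℝ → ℝ} (hU : Measurable U) (hUM : ∀ x, |U x| ≤ M) (f : ℝ →ᵇ ℂ) (x : ℝ) =>
    intervalIntegrable_weight l (hm hU) (hcast hUM) f 0 x
  have hAf : ∀ p f, ∀ x ∈ Icc (0 : ℝ) 1, A p f x = (Real.exp (-(l * x)) : ℂ) *
      ∫ s in (0 : ℝ)..x, (Real.exp (l * s) : ℂ) * ((bp p s : ℂ) * f s) := fun p f x hx => by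
    have hsplit : ∀ s : ℝ, (Real.exp (l * s) : ℂ) * ((bp p s : ℂ) * f s)
        = (Real.exp (l * s) : ℂ) * ((b s : ℂ) * f s)
          + (p.2.1 : ℂ) * ((Real.exp (l * s) : ℂ) * ((U₀ s : ℂ) * f s))
          + (p.2.2.re : ℂ) * ((Real.exp (l * s) : ℂ) * ((U₁ s : ℂ) * f s))
          + (p.2.2.im : ℂ) * ((Real.exp (l * s) : ℂ) * ((U₂ s : ℂ) * f s)) := fun s => by
      simp only [bp]
      push_cast
      ring
    have i0 := hii hb hbM f x
    have i1 := (hii hU₀ hU₀M f x).const_mul (p.2.1 : ℂ)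
    have i2 := (hii hU₁ hU₁M f x).const_mul (p.2.2.re : ℂ)
    have i3 := (hii hU₂ hU₂M f x).const_mul (p.2.2.im : ℂ)
    rw [intervalIntegral.integral_congr fun s _ => hsplit s,
      intervalIntegral.integral_add ((i0.add i1).add i2) i3,
      intervalIntegral.integral_add (i0.add i1) i2, intervalIntegral.integral_add i0 i1,
      intervalIntegral.integral_const_mul, intervalIntegral.integral_const_mul,
      intervalIntegral.integral_const_mul]
    simp only [A, add_apply, smul_apply,
      BoundedContinuousFunction.coe_add, BoundedContinuousFunction.coe_smul, Pi.add_apply,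
      smul_eq_mul, hKbf f x hx, hK₀f f x hx, hK₁f f x hx, hK₂f f x hx]
    ring
  have hsol : ∀ p, zt p + (kt p • J.comp (A p)) (zt p) = e → ∃ u, IsODE (kt p) (bp p)
      (fun x => (Real.exp (l * x) : ℂ) * zt p x) u ∧ u 0 = 0 ∧ zt p 0 = 1 := fun p hp => by
    refine isODE_of_volterra (hbp p) (hbpM p) (u := A p (zt p)) (hAf p (zt p)) fun x hx => ?_
    have h2 := congrArg (fun f : ℝ →ᵇ ℂ => f x) hp
    simp only [he x hx] at h2
    rw [← hJf _ x hx, ← h2]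
    simp
  have hexp1 : (Real.exp (-(l * 1)) : ℂ) * (Real.exp (l * 1) : ℂ) = 1 := by
    rw [← Complex.ofReal_mul, ← Real.exp_add]; simp
  have hev : ∀ {U : ℝ → ℝ} {Λ : (ℝ →ᵇ ℂ) →L[ℂ] (ℝ →ᵇ ℂ)}, (∀ f : ℝ →ᵇ ℂ, ∀ x ∈ Icc (0 : ℝ) 1,
      Λ f x = (Real.exp (-(l * x)) : ℂ) *
        ∫ s in (0 : ℝ)..x, (Real.exp (l * s) : ℂ) * ((U s : ℂ) * yc s * f s)) → ∀ f : ℝ →ᵇ ℂ,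
      ev (Λ f) = (Real.exp (-(l * 1)) : ℂ) *
        ∫ s in (0 : ℝ)..1, (U s : ℂ) * (y s * ((Real.exp (l * s) : ℂ) * f s)) := fun hΛ f => by
    rw [BoundedContinuousFunction.evalCLM_apply, hΛ f 1 (by simp)]
    congr 1
    refine intervalIntegral.integral_congr fun s hs => ?_
    rw [uIcc_of_le zero_le_one] at hs
    simp only [hyc, clamp_of_mem hs]
    ring
  have hz0 : ∀ x ∈ Icc (0 : ℝ) 1, (Real.exp (l * x) : ℂ) * zt 0 x = y x := fun x hx => by
    obtain ⟨u, hu, hu0, hz0⟩ := hsol 0 hev_eq.self_of_nhds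
    have hbp0 : bp 0 = b := by ext s; simp [bp]
    rw [hkt0, hbp0] at hu
    have := ((hu.lincomb h 1 (-1)).eq_zero hbM (x₀ := 0) (by simp) (by simp [hz0, hy0])
      (by simp [hu0, hv0]) x hx).1
    linear_combination this
  have hev0 : ∀ U : ℝ → ℝ, ∫ s in (0 : ℝ)..1, (U s : ℂ) * (y s * ((Real.exp (l * s) : ℂ) * zt 0 s))
      = ∫ s in (0 : ℝ)..1, (U s : ℂ) * y s ^ 2 := fun U => by
    refine intervalIntegral.integral_congr fun s hs => ?_
    rw [uIcc_of_le zero_le_one] at hs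
    simp only [hz0 s hs]
    ring
  have hG0 : G 0 = 0 := by simp [G, hkt0]
  have hd : ∀ (a : ℝ) (w : ℂ), HasDerivAt (fun s : ℝ => G (s • ((0 : ℝ), a, w)))
      (κ ^ 2 * (Real.exp (-(l * 1)) : ℂ) * w) 0 := fun a w => by
    have hline : HasDerivAt (fun s : ℝ => s • ((0 : ℝ), a, w)) ((0 : ℝ), a, w) 0 := by
      simpa using (hasDerivAt_id (0 : ℝ)).smul_const ((0 : ℝ), a, w)
    let Ψ : (ℝ →ᵇ ℂ) →L[ℂ] ℂ := κ ^ 2 • ((a : ℂ) • ev.comp Λ₀ + (w.re : ℂ) • ev.comp Λ₁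
      + (w.im : ℂ) • ev.comp Λ₂)
    have hdiff : DifferentiableAt ℝ (fun s : ℝ => Ψ (zt (s • ((0 : ℝ), a, w)))) 0 := by
      have h1 : DifferentiableAt ℝ (fun p => Ψ (zt p)) ((0 : ℝ) • ((0 : ℝ), a, w)) := by
        rw [zero_smul]; exact (hlin Ψ).differentiableAt (by norm_num)
      exact DifferentiableAt.comp (g := fun p => Ψ (zt p)) (0 : ℝ) h1 hline.differentiableAt
    -- In this form `G` along a line with `t = 0` is `s` times a differentiable function of `s`, so
    -- its derivative at `0` is that function's value: the derivative of the solution in the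
    -- parameter is never computed.
    have hprod := (Complex.ofRealCLM.hasDerivAt (x := (0 : ℝ))).mul hdiff.hasDerivAt
    convert! hprod using 1
    · ext s
      simp [G, kt, Ψ]
      ring_nf
    · simp only [Ψ, zero_smul, smul_apply, add_apply,
        ContinuousLinearMap.comp_apply, hev hΛ₀, hev hΛ₁, hev hΛ₂, hev0, h₀, h₁, h₂, smul_eq_mul]
      simp only [Complex.ofRealCLM_apply, Complex.ofReal_zero, Complex.ofReal_one]
      linear_combination (-κ ^ 2 * (Real.exp (-(l * 1)) : ℂ)) * Complex.re_add_im w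
  obtain ⟨C, hC, hcurve⟩ := exists_zero_curve hG hG0
    (mul_ne_zero (pow_ne_zero 2 hκ) (by exact_mod_cast (Real.exp_pos _).ne')) hd
  refine ⟨C, hC, fun D ε hε => ?_⟩
  have hP : ∀ᶠ p : ℝ × ℝ × ℂ in 𝓝 0, p.1 < ε ∧ zt p + (kt p • J.comp (A p)) (zt p) = e := by
    refine Filter.Eventually.and ?_ ?_
    · exact (continuous_fst.tendsto (0 : ℝ × ℝ × ℂ)).eventually (gt_mem_nhds hε)
    · exact hev_eq
  obtain ⟨t, w, ht, hw, ⟨htε, hunit⟩, hGz⟩ := hcurve D _ hP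
  refine ⟨t, w, ht, htε, hw, ?_⟩
  obtain ⟨u, hu, hu0, hz0'⟩ := hsol _ hunit
  refine ⟨_, u, hu, hu0, by simp [hz0'], ?_⟩
  set p : ℝ × ℝ × ℂ := (t, D * t, w) with hp
  set f := zt p
  have hint : ∀ {U : ℝ → ℝ}, Measurable U → (∀ x, |U x| ≤ M) → IntervalIntegrable
      (fun s => (U s : ℂ) * (y s * ((Real.exp (l * s) : ℂ) * f s))) volume 0 1 :=
    fun {U} hU hUM => by
      refine (intervalIntegrable_weight l (hmy hU) (hycM hUM) f 0 1).congr fun s hs => ?_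
      rw [uIoc_of_le zero_le_one] at hs
      simp only [hyc, clamp_of_mem (Ioc_subset_Icc_self hs)]
      ring
  have hw1 := h.wronskian hu hb (hbp p) (M := M * (1 + |p.2.1| + |p.2.2.re| + |p.2.2.im|))
    (fun x => (hbM x).trans (le_mul_of_one_le_right hM0 (by
      have := abs_nonneg p.2.1; have := abs_nonneg p.2.2.re; have := abs_nonneg p.2.2.im
      linarith))) (hbpM p) (x := 1) (by simp)
  have hsplit : ∀ s : ℝ, (κ ^ 2 * b s - kt p * bp p s) * (y s * ((Real.exp (l * s) : ℂ) * f s))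
      = (κ ^ 2 - kt p) * ((b s : ℂ) * (y s * ((Real.exp (l * s) : ℂ) * f s)))
        - ((kt p * (D * t : ℝ)) * ((U₀ s : ℂ) * (y s * ((Real.exp (l * s) : ℂ) * f s)))
        + (kt p * w.re) * ((U₁ s : ℂ) * (y s * ((Real.exp (l * s) : ℂ) * f s)))
        + (kt p * w.im) * ((U₂ s : ℂ) * (y s * ((Real.exp (l * s) : ℂ) * f s)))) := fun s => by
    simp only [bp, hp]
    push_cast
    ring
  have i0 := (hint hb hbM).const_mul (κ ^ 2 - kt p)
  have i1 := (hint hU₀ hU₀M).const_mul (kt p * (D * t : ℝ))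
  have i2 := (hint hU₁ hU₁M).const_mul (kt p * w.re)
  have i3 := (hint hU₂ hU₂M).const_mul (kt p * w.im)
  rw [intervalIntegral.integral_congr fun s _ => hsplit s,
    intervalIntegral.integral_sub i0 ((i1.add i2).add i3),
    intervalIntegral.integral_add (i1.add i2) i3, intervalIntegral.integral_add i1 i2,
    intervalIntegral.integral_const_mul, intervalIntegral.integral_const_mul,
    intervalIntegral.integral_const_mul, intervalIntegral.integral_const_mul, hv0, hu0, hv1] at hw1
  have hGz' : kt p * (((D * t : ℝ) : ℂ) * ev (Λ₀ f) + (w.re : ℂ) * ev (Λ₁ f)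
      + (w.im : ℂ) * ev (Λ₂ f)) - (κ ^ 2 - kt p) * ev (Λb f)
      + Complex.I * (Complex.I * t) * y 1 * f 1 = 0 := hGz
  rw [hev hΛ₀, hev hΛ₁, hev hΛ₂, hev hΛb] at hGz'
  have hfin : y 1 * (u 1 + Complex.I * (κ - Complex.I * t) * ((Real.exp (l * 1) : ℂ) * f 1))
      = 0 := by
    linear_combination hw1 - (Real.exp (l * 1) : ℂ) * hGz' + (
      (kt p * (D * t : ℝ)) * (∫ s in (0 : ℝ)..1, (U₀ s : ℂ) * (y s * ((Real.exp (l * s) : ℂ) * f s)))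
      + (kt p * w.re) * (∫ s in (0 : ℝ)..1, (U₁ s : ℂ) * (y s * ((Real.exp (l * s) : ℂ) * f s)))
      + (kt p * w.im) * (∫ s in (0 : ℝ)..1, (U₂ s : ℂ) * (y s * ((Real.exp (l * s) : ℂ) * f s)))
      - (κ ^ 2 - kt p) * (∫ s in (0 : ℝ)..1, (b s : ℂ) * (y s * ((Real.exp (l * s) : ℂ) * f s))))
      * hexp1
  exact eq_neg_of_add_eq_zero_left ((mul_eq_zero.1 hfin).resolve_left hy1)

/-! ### Pointwise representatives and normalised modes. -/

/-- Everywhere defined measurable representatives of admissible coefficients. -/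
def AdFun (b₁ b₂ : ℝ) : Set (ℝ → ℝ) := {b | Measurable b ∧ ∀ x, b x ∈ Icc b₁ b₂}

/-- `κ` is a quasi-eigenvalue of the coefficient `b`, with mode `y` normalised by `y(0) = 1`. -/
structure IsMode (κ : ℂ) (b : ℝ → ℝ) (y v : ℝ → ℂ) : Prop where
  ode : IsODE (κ ^ 2) b y v
  deriv_zero : v 0 = 0
  val_zero : y 0 = 1
  deriv_one : v 1 = -(Complex.I * κ * y 1)

theorem AdFun.abs_le {b₁ b₂ : ℝ} (hb₁ : 0 ≤ b₁) {b : ℝ → ℝ} (hb : b ∈ AdFun b₁ b₂) (x : ℝ) :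
    |b x| ≤ b₂ := by
  rw [abs_of_nonneg (hb₁.trans (hb.2 x).1)]
  exact (hb.2 x).2

theorem IsODE.congr_ae {k : ℂ} {b b' : ℝ → ℝ} {y v : ℝ → ℂ} (h : IsODE k b y v)
    (hbb : ∀ᵐ x ∂vol01, b x = b' x) : IsODE k b' y v where
  hasDeriv := h.hasDeriv
  absCont := h.absCont
  equation := by
    filter_upwards [h.equation, hbb] with x hx hx'
    rwa [← hx']

/-- The boundary condition at `1` would make both Cauchy data vanish there, contradicting `y(0) =
1`. -/
theorem IsMode.val_one_ne_zero {κ : ℂ} {b : ℝ → ℝ} {y v : ℝ → ℂ} (h : IsMode κ b y v) {M : ℝ}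
    (hM : ∀ x, |b x| ≤ M) : y 1 ≠ 0 := fun h1 => by
  have h2 : v 1 = 0 := by rw [h.deriv_one, h1]; ring
  have := (h.ode.eq_zero hM (x₀ := 1) (by simp) h1 h2 0 (by simp)).1
  rw [h.val_zero] at this
  exact one_ne_zero this

/-- The way back from functions to classes: every mode constructed with a pointwise admissible
coefficient can be tested against the minimality defining `I`. -/
theorem IsMode.mem_KAd {b₁ b₂ : ℝ} (hb₁ : 0 ≤ b₁) {κ : ℂ} (hκ : κ ≠ 0) {b : ℝ → ℝ}
    (hb : b ∈ AdFun b₁ b₂) {y v : ℝ → ℂ} (h : IsMode κ b y v) : κ ∈ KAd b₁ b₂ := by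
  have hmem : MemLp b ∞ vol01 := memLp_top_of_bound hb.1.aestronglyMeasurable b₂
    (Filter.Eventually.of_forall fun x => by simpa using AdFun.abs_le hb₁ hb x)
  have hae := hmem.coeFn_toLp
  refine mem_iUnion₂.2 ⟨hmem.toLp b, ?_, hκ, y, v, ?_, 0, by simp, by simp [h.val_zero]⟩
  · change ∀ᵐ x ∂vol01, _
    filter_upwards [hae] with x hx
    rw [hx]
    exact hb.2 x
  · have h' := h.ode.congr_ae (hae.mono fun x hx => hx.symm)
    refine ⟨h'.hasDeriv, h'.absCont, h'.equation, h.deriv_zero, ?_⟩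
    rw [h.deriv_one]
    field_simp
    linear_combination y 1 * Complex.I_sq

/-- Truncating a representative to `[b₁, b₂]` makes the bounds hold everywhere. Since `y'(0) = 0`,
uniqueness gives `y(0) ≠ 0`, so the mode can be rescaled. -/
theorem exists_isMode {b₁ b₂ : ℝ} (hb₁ : 0 ≤ b₁) (hb₁₂ : b₁ ≤ b₂) {B : LInf01}
    (hB : B ∈ Ad b₁ b₂) {κ : ℂ} (hκ : κ ∈ K B) :
    ∃ b ∈ AdFun b₁ b₂, (∀ᵐ x ∂vol01, B x = b x) ∧ κ ≠ 0 ∧ ∃ y v, IsMode κ b y v := by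
  obtain ⟨hκ0, y, v, h, x₁, hx₁, hyx₁⟩ := hκ
  set b : ℝ → ℝ := fun x => max b₁ (min b₂ (B x)) with hbdef
  have hb : b ∈ AdFun b₁ b₂ := ⟨by
    have := (Lp.stronglyMeasurable B).measurable
    fun_prop, fun x => ⟨le_max_left _ _, max_le hb₁₂ (min_le_left _ _)⟩⟩
  have hBb : ∀ᵐ x ∂vol01, B x = b x := by
    have hB' : ∀ᵐ x ∂vol01, b₁ ≤ B x ∧ B x ≤ b₂ := hB
    filter_upwards [hB'] with x hx
    simp [hbdef, hx.1, hx.2]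
  refine ⟨b, hb, hBb, hκ0, ?_⟩
  have hode : IsODE (κ ^ 2) b y v :=
    IsODE.congr_ae ⟨h.hasDeriv, h.absCont, h.equation⟩ hBb
  have hy0 : y 0 ≠ 0 := fun h0 =>
    hyx₁ (hode.eq_zero (AdFun.abs_le hb₁ hb) (x₀ := 0) (by simp) h0 h.bc_zero x₁ hx₁).1
  refine ⟨fun x => (y 0)⁻¹ * y x + 0 * y x, fun x => (y 0)⁻¹ * v x + 0 * v x,
    hode.lincomb hode _ _, ?_, ?_, ?_⟩
  · simp [h.bc_zero]
  · simp [hy0]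
  · have := h.bc_one
    field_simp at this ⊢
    linear_combination Complex.I * this + v 1 * Complex.I_sq

/-! ### First variation and the bang-bang property. -/

/-- A convex subset of the plane containing `0` contains `0` in its interior or lies in a closed
half plane whose boundary passes through `0`. -/
theorem interior_or_halfplane {S : Set ℂ} (hS : Convex ℝ S) (h0 : (0 : ℂ) ∈ S) :
    (0 : ℂ) ∈ interior S ∨ ∃ c : ℂ, c ≠ 0 ∧ ∀ s ∈ S, (c * s).re ≤ 0 := by
  by_cases hint : (0 : ℂ) ∈ interior S
  · exact Or.inl hint
  right
  -- With empty interior, `S` spans a proper subspace and some nonzero functional kills it;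
  -- otherwise `0` is separated from the open convex interior, and the inequality passes to the
  -- closure.
  have key : ∃ f : ℂ →L[ℝ] ℝ, f ≠ 0 ∧ ∀ s ∈ S, f s ≤ 0 := by
    rcases (interior S).eq_empty_or_nonempty with he | hne
    · have hspan : affineSpan ℝ S ≠ ⊤ := fun h =>
        (hS.interior_nonempty_iff_affineSpan_eq_top.2 h).ne_empty he
      have hlt : Submodule.span ℝ S < ⊤ := by
        refine lt_top_iff_ne_top.2 fun h => hspan ?_
        rw [AffineSubspace.affineSpan_eq_top_iff_vectorSpan_eq_top_of_nonempty ℝ ℂ ℂ ⟨0, h0⟩,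
          vectorSpan_eq_span_vsub_set_right ℝ h0]
        simpa using h
      obtain ⟨f, hf, hle⟩ := Submodule.exists_le_ker_of_lt_top _ hlt
      refine ⟨LinearMap.toContinuousLinearMap f, by simpa using hf, fun s hs => ?_⟩
      have : f s = 0 := hle (Submodule.subset_span hs)
      simp [this]
    · obtain ⟨f, hf⟩ := geometric_hahn_banach_open_point hS.interior isOpen_interior hint
      refine ⟨f, ?_, fun s hs => ?_⟩
      · rintro rfl
        obtain ⟨x, hx⟩ := hne
        simpa using hf x hx
      · have hcl : s ∈ closure (interior S) := by
          rw [hS.closure_interior_eq_closure_of_nonempty_interior hne]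
          exact subset_closure hs
        have : closure (interior S) ⊆ {x | f x ≤ 0} :=
          closure_minimal (fun x hx => by simpa using (hf x hx).le)
            (isClosed_le f.continuous continuous_const)
        exact this hcl
  obtain ⟨f, hf, hfS⟩ := key
  have hfz : ∀ z : ℂ, f z = z.re * f 1 + z.im * f Complex.I := fun z => by
    have : z = z.re • (1 : ℂ) + z.im • Complex.I := by simp [Complex.re_add_im]
    conv_lhs => rw [this, map_add, map_smul, map_smul, smul_eq_mul, smul_eq_mul]
  -- The coefficient that represents `f` as `z ↦ Re (c z)`.
  refine ⟨(f 1 : ℂ) - f Complex.I * Complex.I, fun hc => hf ?_, fun s hs => ?_⟩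
  · have h1 := congrArg Complex.re hc
    have h2 := congrArg Complex.im hc
    simp at h1 h2
    ext z
    simp [hfz z, h1, h2]
  · have := hfS s hs
    rw [hfz] at this
    simp
    linarith

section Variation

variable {b₁ b₂ : ℝ} {b : ℝ → ℝ} {y v : ℝ → ℂ} {κ : ℂ}

theorem intervalIntegrable_mul_sq (h : IsODE κ b y v) {U : ℝ → ℝ} (hU : Measurable U) {M : ℝ}
    (hM : ∀ x, |U x| ≤ M) :
    IntervalIntegrable (fun s => (U s : ℂ) * y s ^ 2) volume 0 1 := by
  refine IntervalIntegrable.mul_continuousOn ?_ ?_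
  · refine intervalIntegrable_of_bound (M := M) ?_ (by fun_prop)
    exact Filter.Eventually.of_forall fun x => by simpa using hM x
  · rw [uIcc_of_le zero_le_one]
    exact h.continuousOn.pow 2

/-- If the first variation covers a neighbourhood of `0`, then `κ` can be moved straight down. -/
theorem exists_lower_mode (hb₁ : 0 ≤ b₁) (hb : b ∈ AdFun b₁ b₂) (h : IsMode κ b y v)
    (hκ : κ ≠ 0)
    (hint : (0 : ℂ) ∈ interior ((fun a : ℝ → ℝ => ∫ s in (0 : ℝ)..1, ((a s - b s : ℝ) : ℂ) * y s ^ 2)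
      '' AdFun b₁ b₂)) :
    ∃ t : ℝ, 0 < t ∧ ∃ b' ∈ AdFun b₁ b₂, ∃ z u, IsMode (κ - Complex.I * t) b' z u := by
  have hbM := AdFun.abs_le hb₁ hb
  have hb₂ : 0 ≤ b₂ := (abs_nonneg _).trans (hbM 0)
  obtain ⟨R, hR, hball⟩ := Metric.mem_nhds_iff.1 (mem_interior_iff_mem_nhds.1 hint)
  set r : ℝ := R / 2 with hr
  have hr0 : 0 < r := by positivity
  have hrR : r < R := by rw [hr]; linarith
  have hmem : ∀ z : ℂ, ‖z‖ = 1 → ∃ a ∈ AdFun b₁ b₂,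
      ∫ s in (0 : ℝ)..1, ((a s - b s : ℝ) : ℂ) * y s ^ 2 = r * z := fun z hz => by
    refine hball ?_
    rw [mem_ball_zero_iff, norm_mul, hz, Complex.norm_real, Real.norm_of_nonneg hr0.le]
    linarith
  -- Four competitors with first variations `r`, `ir`, `-r`, `-ir`: opposite pairs give `U₁` and
  -- `U₂`, while the sum of all four has zero variation and serves as `U₀`.
  obtain ⟨a₁, ha₁, e₁⟩ := hmem 1 (by simp)
  obtain ⟨a₂, ha₂, e₂⟩ := hmem Complex.I (by simp)
  obtain ⟨a₃, ha₃, e₃⟩ := hmem (-1) (by simp)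
  obtain ⟨a₄, ha₄, e₄⟩ := hmem (-Complex.I) (by simp)
  have hV : ∀ {a : ℝ → ℝ}, a ∈ AdFun b₁ b₂ → ∀ x, |a x - b x| ≤ b₂ := fun ha x => by
    have h1 := ha.2 x
    have h2 := hb.2 x
    rw [abs_le]
    constructor <;> linarith [h1.1, h1.2, h2.1, h2.2]
  have hi : ∀ {a : ℝ → ℝ}, a ∈ AdFun b₁ b₂ → IntervalIntegrable
      (fun s => ((a s - b s : ℝ) : ℂ) * y s ^ 2) volume 0 1 := fun ha =>
    intervalIntegrable_mul_sq h.ode (ha.1.sub hb.1) (hV ha)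
  have m₁ := ha₁.1
  have m₂ := ha₂.1
  have m₃ := ha₃.1
  have m₄ := ha₄.1
  have m := hb.1
  set M : ℝ := 4 * b₂ + b₂ / r with hM
  have hbr : 0 ≤ b₂ / r := by positivity
  have hdiff : ∀ {a a' : ℝ → ℝ}, a ∈ AdFun b₁ b₂ → a' ∈ AdFun b₁ b₂ → ∀ x,
      |(1 / (2 * r)) * ((a x - b x) - (a' x - b x))| ≤ M := fun {a a'} ha ha' x => by
    rw [abs_mul, abs_of_pos (by positivity)]
    calc 1 / (2 * r) * |(a x - b x) - (a' x - b x)| ≤ 1 / (2 * r) * (b₂ + b₂) := by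
          gcongr
          exact (abs_sub _ _).trans (add_le_add (hV ha x) (hV ha' x))
      _ = b₂ / r := by field_simp; ring
      _ ≤ M := by linarith
  have hdiffint : ∀ {a a' : ℝ → ℝ}, a ∈ AdFun b₁ b₂ → a' ∈ AdFun b₁ b₂ →
      ∫ s in (0 : ℝ)..1, (((1 / (2 * r)) * ((a s - b s) - (a' s - b s)) : ℝ) : ℂ) * y s ^ 2
      = (1 / (2 * r)) * ((∫ s in (0 : ℝ)..1, ((a s - b s : ℝ) : ℂ) * y s ^ 2)
        - ∫ s in (0 : ℝ)..1, ((a' s - b s : ℝ) : ℂ) * y s ^ 2) := fun {a a'} ha ha' => by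
    rw [← intervalIntegral.integral_sub (hi ha) (hi ha'), ← intervalIntegral.integral_const_mul]
    refine intervalIntegral.integral_congr fun s _ => ?_
    push_cast
    ring
  have hrC : (r : ℂ) ≠ 0 := by exact_mod_cast hr0.ne'
  obtain ⟨C, hC, hpert⟩ := exists_perturbed_eigenvalue hκ (M := M)
    (U₀ := fun x => (a₁ x - b x) + (a₂ x - b x) + (a₃ x - b x) + (a₄ x - b x))
    (U₁ := fun x => (1 / (2 * r)) * ((a₁ x - b x) - (a₃ x - b x)))
    (U₂ := fun x => (1 / (2 * r)) * ((a₂ x - b x) - (a₄ x - b x)))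
    m (fun x => (hbM x).trans (by linarith)) (by fun_prop)
    (fun x => by
      have := hV ha₁ x; have := hV ha₂ x; have := hV ha₃ x; have := hV ha₄ x
      refine (abs_add_le _ _).trans ((add_le_add_left ((abs_add_le _ _).trans
        (add_le_add_left (abs_add_le _ _) _)) _).trans ?_)
      linarith)
    (by fun_prop) (hdiff ha₁ ha₃) (by fun_prop) (hdiff ha₂ ha₄) h.ode h.deriv_zero h.val_zero
    h.deriv_one (h.val_one_ne_zero hbM)
    (by
      have : ∀ s, (((a₁ s - b s) + (a₂ s - b s) + (a₃ s - b s) + (a₄ s - b s) : ℝ) : ℂ) * y s ^ 2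
          = ((a₁ s - b s : ℝ) : ℂ) * y s ^ 2 + ((a₂ s - b s : ℝ) : ℂ) * y s ^ 2
          + ((a₃ s - b s : ℝ) : ℂ) * y s ^ 2 + ((a₄ s - b s : ℝ) : ℂ) * y s ^ 2 := fun s => by
        push_cast
        ring
      rw [intervalIntegral.integral_congr fun s _ => this s,
        intervalIntegral.integral_add (((hi ha₁).add (hi ha₂)).add (hi ha₃)) (hi ha₄),
        intervalIntegral.integral_add ((hi ha₁).add (hi ha₂)) (hi ha₃),
        intervalIntegral.integral_add (hi ha₁) (hi ha₂), e₁, e₂, e₃, e₄]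
      ring)
    (by rw [hdiffint ha₁ ha₃, e₁, e₃]; field_simp; ring)
    (by rw [hdiffint ha₂ ha₄, e₂, e₄]; field_simp; ring)
  -- The `U₀` term gives each competitor the weight `D t`, and this `D` makes it dominate the
  -- corrections `|Re w| / (2r)` and `|Im w| / (2r)`, both at most `C t / (2r)`. Taking `t < 1 /
  -- (4D)` leaves a nonnegative weight for `b`, so the perturbed coefficient is a convex combination
  -- of admissible ones. The choice is possible because `C` was fixed before `D`.
  set D : ℝ := C / (2 * r) with hD
  have hD0 : 0 < D := by positivity
  obtain ⟨t, w, ht, htε, hw, z, u, hode, hu0, hz0, hu1⟩ := hpert D (1 / (4 * D)) (by positivity)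
  refine ⟨t, ht, _, ?_, z, u, hode, hu0, hz0, hu1⟩
  have hsum : 4 * (D * t) ≤ 1 := by
    rw [lt_div_iff₀ (by positivity)] at htε
    linarith
  have hcoef : ∀ q : ℝ, |q| ≤ ‖w‖ → |1 / (2 * r) * q| ≤ D * t := fun q hq => by
    rw [abs_mul, abs_of_pos (by positivity)]
    calc 1 / (2 * r) * |q| ≤ 1 / (2 * r) * (C * t) := by gcongr; exact hq.trans hw
      _ = D * t := by rw [hD]; ring
  have h1 := abs_le.1 (hcoef _ (Complex.abs_re_le_norm w))
  have h2 := abs_le.1 (hcoef _ (Complex.abs_im_le_norm w))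
  set p := 1 / (2 * r) * w.re with hp
  set q := 1 / (2 * r) * w.im with hq
  refine ⟨by fun_prop, fun x => ?_⟩
  have hconv : b x + D * t * ((a₁ x - b x) + (a₂ x - b x) + (a₃ x - b x) + (a₄ x - b x))
      + w.re * ((1 / (2 * r)) * ((a₁ x - b x) - (a₃ x - b x)))
      + w.im * ((1 / (2 * r)) * ((a₂ x - b x) - (a₄ x - b x)))
      = (1 - 4 * (D * t)) * b x + (D * t + p) * a₁ x + (D * t + q) * a₂ x + (D * t - p) * a₃ x
        + (D * t - q) * a₄ x := by
    rw [hp, hq]; ring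
  simp only [hconv]
  have x0 := hb.2 x
  have x1 := ha₁.2 x
  have x2 := ha₂.2 x
  have x3 := ha₃.2 x
  have x4 := ha₄.2 x
  have c0 : 0 ≤ 1 - 4 * (D * t) := by linarith
  have c1 : 0 ≤ D * t + p := by linarith
  have c2 : 0 ≤ D * t + q := by linarith
  have c3 : 0 ≤ D * t - p := by linarith
  have c4 : 0 ≤ D * t - q := by linarith
  constructor
  · have := mul_le_mul_of_nonneg_left x0.1 c0
    have := mul_le_mul_of_nonneg_left x1.1 c1
    have := mul_le_mul_of_nonneg_left x2.1 c2
    have := mul_le_mul_of_nonneg_left x3.1 c3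
    have := mul_le_mul_of_nonneg_left x4.1 c4
    linarith
  · have := mul_le_mul_of_nonneg_left x0.2 c0
    have := mul_le_mul_of_nonneg_left x1.2 c1
    have := mul_le_mul_of_nonneg_left x2.2 c2
    have := mul_le_mul_of_nonneg_left x3.2 c3
    have := mul_le_mul_of_nonneg_left x4.2 c4
    linarith

/-- If `κ` cannot be moved straight down, then `b` is of bang-bang type. -/
theorem bang_bang (hb₁ : 0 ≤ b₁) (hb₁₂ : b₁ ≤ b₂) (hb : b ∈ AdFun b₁ b₂) (h : IsMode κ b y v)
    (hκ : κ ≠ 0) (hmin : ∀ t : ℝ, 0 < t → ∀ b' ∈ AdFun b₁ b₂, ∀ z u,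
      ¬ IsMode (κ - Complex.I * t) b' z u) :
    ∃ c : ℂ, c ≠ 0 ∧ ∀ᵐ x ∂vol01,
      (0 < (c * y x ^ 2).re → b x = b₂) ∧ ((c * y x ^ 2).re < 0 → b x = b₁) := by
  have hbM := AdFun.abs_le hb₁ hb
  have hi : ∀ {a : ℝ → ℝ}, a ∈ AdFun b₁ b₂ → IntervalIntegrable
      (fun s => ((a s : ℝ) : ℂ) * y s ^ 2) volume 0 1 := fun ha =>
    intervalIntegrable_mul_sq h.ode ha.1 (AdFun.abs_le hb₁ ha)
  have hsub : ∀ {a : ℝ → ℝ}, a ∈ AdFun b₁ b₂ →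
      ∫ s in (0 : ℝ)..1, ((a s - b s : ℝ) : ℂ) * y s ^ 2
      = (∫ s in (0 : ℝ)..1, (a s : ℂ) * y s ^ 2) - ∫ s in (0 : ℝ)..1, (b s : ℂ) * y s ^ 2 :=
    fun {a} ha => by
      rw [← intervalIntegral.integral_sub (hi ha) (hi hb)]
      refine intervalIntegral.integral_congr fun s _ => ?_
      push_cast
      ring
  set S := (fun a : ℝ → ℝ => ∫ s in (0 : ℝ)..1, ((a s - b s : ℝ) : ℂ) * y s ^ 2) '' AdFun b₁ b₂
    with hS
  have hconv : Convex ℝ S := by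
    rintro _ ⟨a, ha, rfl⟩ _ ⟨a', ha', rfl⟩ p q hp hq hpq
    have hmem : (fun x => p * a x + q * a' x) ∈ AdFun b₁ b₂ := by
      have m := ha.1
      have m' := ha'.1
      exact ⟨by fun_prop, fun x => convex_Icc b₁ b₂ (ha.2 x) (ha'.2 x) hp hq hpq⟩
    refine ⟨_, hmem, ?_⟩
    simp only
    rw [hsub hmem, hsub ha, hsub ha']
    have : ∫ s in (0 : ℝ)..1, ((p * a s + q * a' s : ℝ) : ℂ) * y s ^ 2
        = p * (∫ s in (0 : ℝ)..1, (a s : ℂ) * y s ^ 2)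
          + q * ∫ s in (0 : ℝ)..1, (a' s : ℂ) * y s ^ 2 := by
      rw [← intervalIntegral.integral_const_mul, ← intervalIntegral.integral_const_mul,
        ← intervalIntegral.integral_add ((hi ha).const_mul _) ((hi ha').const_mul _)]
      refine intervalIntegral.integral_congr fun s _ => ?_
      push_cast
      ring
    rw [this, Complex.real_smul, Complex.real_smul]
    have hpq' : (p : ℂ) + q = 1 := by exact_mod_cast hpq
    linear_combination (∫ s in (0 : ℝ)..1, (b s : ℂ) * y s ^ 2) * hpq'
  have h0 : (0 : ℂ) ∈ S := ⟨b, hb, by simp⟩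
  rcases interior_or_halfplane hconv h0 with hint | ⟨c, hc, hcS⟩
  · obtain ⟨t, ht, b', hb', z, u, hzu⟩ := exists_lower_mode hb₁ hb h hκ hint
    exact absurd hzu (hmin t ht b' hb' z u)
  refine ⟨c, hc, ?_⟩
  set g : ℝ → ℝ := fun x => (c * y (clamp x) ^ 2).re with hg
  have hgc : Continuous g := Complex.continuous_re.comp (continuous_const.mul
    ((h.ode.continuousOn.comp_continuous continuous_clamp clamp_mem).pow 2))
  -- The competitor maximising `∫ a g`. Then `(a - b) g ≥ 0` pointwise, whereas the half plane gives
  -- a nonpositive integral, so the product vanishes a.e.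
  set a : ℝ → ℝ := fun x => if 0 < g x then b₂ else if g x < 0 then b₁ else b x with ha
  have hm := hb.1
  have haF : a ∈ AdFun b₁ b₂ := by
    refine ⟨Measurable.ite (measurableSet_lt measurable_const hgc.measurable) measurable_const
      (Measurable.ite (measurableSet_lt hgc.measurable measurable_const) measurable_const hm),
      fun x => ?_⟩
    simp only [ha]
    split_ifs
    · exact ⟨hb₁₂, le_rfl⟩
    · exact ⟨le_rfl, hb₁₂⟩
    · exact hb.2 x
  have hnn : ∀ x, 0 ≤ (a x - b x) * g x := fun x => by
    have := hb.2 x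
    simp only [ha]
    split_ifs with h1 h2
    · exact mul_nonneg (sub_nonneg.2 this.2) h1.le
    · exact mul_nonneg_of_nonpos_of_nonpos (sub_nonpos.2 this.1) h2.le
    · simp
  have hint2 : IntervalIntegrable (fun x => (a x - b x) * g x) volume 0 1 := by
    refine IntervalIntegrable.mul_continuousOn ?_ hgc.continuousOn
    refine intervalIntegrable_of_bound (M := b₂ + b₂) ?_
      (haF.1.sub hm).aestronglyMeasurable
    exact Filter.Eventually.of_forall fun x =>
      (abs_sub _ _).trans (add_le_add (AdFun.abs_le hb₁ haF x) (hbM x))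
  have hle : ∫ x in (0 : ℝ)..1, (a x - b x) * g x ≤ 0 := by
    have h1 := hcS _ ⟨a, haF, rfl⟩
    simp only [← intervalIntegral.integral_const_mul] at h1
    have h2 : (∫ x in (0 : ℝ)..1, (a x - b x) * g x)
        = (∫ s in (0 : ℝ)..1, c * (((a s - b s : ℝ) : ℂ) * y s ^ 2)).re := by
      have hi2 := (intervalIntegrable_mul_sq h.ode (U := fun x => a x - b x) (haF.1.sub hm)
        (M := b₂ + b₂) fun x =>
        (abs_sub _ _).trans (add_le_add (AdFun.abs_le hb₁ haF x) (hbM x))).const_mul c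
      have := Complex.reCLM.intervalIntegral_comp_comm hi2
      simp only [Complex.reCLM_apply] at this
      rw [← this]
      refine intervalIntegral.integral_congr fun s hs => ?_
      rw [uIcc_of_le zero_le_one] at hs
      simp only [hg, clamp_of_mem hs]
      rw [mul_left_comm, Complex.re_ofReal_mul]
    rw [h2]
    exact h1
  have hzero : ∫ x in (0 : ℝ)..1, (a x - b x) * g x = 0 :=
    le_antisymm hle (intervalIntegral.integral_nonneg zero_le_one fun x _ => hnn x)
  rw [intervalIntegral.integral_of_le zero_le_one, integral_Ioc_eq_integral_Ioo,
    integral_eq_zero_iff_of_nonneg hnn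
      ((intervalIntegrable_iff_integrableOn_Ioo_of_le zero_le_one).1 hint2)] at hzero
  filter_upwards [hzero, self_mem_ae_restrict measurableSet_Ioo] with x hx hx01
  have hgx : (c * y x ^ 2).re = g x := by
    simp only [hg, clamp_of_mem (Ioo_subset_Icc_self hx01)]
  rw [hgx]
  have hx' : (a x - b x) * g x = 0 := hx
  constructor
  · intro hpos
    rcases mul_eq_zero.1 hx' with h1 | h1
    · simp only [ha, if_pos hpos] at h1
      linarith
    · exact absurd h1 hpos.ne'
  · intro hneg
    rcases mul_eq_zero.1 hx' with h1 | h1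
    · simp only [ha, if_neg hneg.not_gt, if_pos hneg] at h1
      linarith
    · exact absurd h1 hneg.ne

end Variation

/-! ### Zero frequency: comparison with the constant coefficient `b₂`. -/

/-- If no solution of smaller frequency exists on the imaginary axis, then `b = b₂` a.e. -/
theorem ae_eq_of_imaginary_mode {b₁ b₂ : ℝ} (hb₁ : 0 ≤ b₁) (hb₁₂ : b₁ ≤ b₂) (hb₂ : 0 < b₂) {b : ℝ → ℝ}
    (hb : b ∈ AdFun b₁ b₂) {β : ℝ} (hβ : β ≠ 0) {y v : ℝ → ℂ}
    (h : IsMode (Complex.I * β) b y v) (hmin : ∀ t : ℝ, t ≠ 0 → t < β → ∀ b' ∈ AdFun b₁ b₂, ∀ z u,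
      ¬ IsMode (Complex.I * t) b' z u) :
    ∀ᵐ x ∂vol01, b x = b₂ := by
  have hbM := AdFun.abs_le hb₁ hb
  have hk : (Complex.I * β) ^ 2 = -((β : ℂ) ^ 2) := by
    rw [mul_pow, Complex.I_sq]; ring
  have hode := h.ode
  rw [hk] at hode
  -- the mode is real
  have hconj := hode.conjugate
  have hkc : conj (-((β : ℂ) ^ 2)) = -((β : ℂ) ^ 2) := by simp
  rw [hkc] at hconj
  have hreal : ∀ x ∈ Icc (0 : ℝ) 1, y x = ((y x).re : ℂ) ∧ v x = ((v x).re : ℂ) := fun x hx => by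
    have := (hode.lincomb hconj 1 (-1)).eq_zero hbM (x₀ := 0) (by simp)
      (by simp [h.val_zero]) (by simp [h.deriv_zero]) x hx
    refine ⟨(Complex.conj_eq_iff_re.1 ?_).symm, (Complex.conj_eq_iff_re.1 ?_).symm⟩
    · linear_combination -this.1
    · linear_combination -this.2
  set p : ℝ → ℝ := fun x => (y x).re with hp
  set q : ℝ → ℝ := fun x => (v x).re with hq
  have hpac : AbsolutelyContinuousOnInterval p 0 1 :=
    ac_lipschitz_comp Complex.reCLM.lipschitz hode.ac
  have hqac : AbsolutelyContinuousOnInterval q 0 1 :=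
    ac_lipschitz_comp Complex.reCLM.lipschitz hode.absCont
  have hpd : ∀ᵐ x ∂vol01, HasDerivAt p (q x) x := by
    filter_upwards [hode.ae_hasDerivAt] with x hx using
      Complex.reCLM.hasFDerivAt.comp_hasDerivAt x hx
  have hqd : ∀ᵐ x ∂vol01, HasDerivAt q (β ^ 2 * b x * p x) x := by
    filter_upwards [hode.equation, self_mem_ae_restrict measurableSet_Ioo] with x hx hx01
    have h1 := Complex.reCLM.hasFDerivAt.comp_hasDerivAt x hx
    convert! h1 using 1
    rw [(hreal x (Ioo_subset_Icc_self hx01)).1]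
    rw [Complex.reCLM_apply, neg_mul, neg_mul, neg_neg]
    exact_mod_cast rfl
  have hp0 : p 0 = 1 := by simp [hp, h.val_zero]
  have hq0 : q 0 = 0 := by simp [hq, h.deriv_zero]
  have hq1 : q 1 = β * p 1 := by
    have h1 : v 1 = β * y 1 := by
      rw [h.deriv_one]; linear_combination (-β * y 1) * Complex.I_sq
    simp only [hp, hq, h1, Complex.re_ofReal_mul]
  -- `(p p')' = p'² + β² b p² ≥ 0` and `p p' = 0` at `0`, so `p²` increases from `1`; thus `p` has
  -- no zero and stays positive.
  have hpqmono : MonotoneOn (fun x => p x * q x) (Icc 0 1) := by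
    refine ac_monotoneOn (hpac.fun_mul hqac) ?_
    filter_upwards [hpd, hqd] with x h1 h2
    refine ⟨_, ?_, h1.mul h2⟩
    have : 0 ≤ b x := hb₁.trans (hb.2 x).1
    have : 0 ≤ q x * q x := mul_self_nonneg _
    have : p x * (β ^ 2 * b x * p x) = β ^ 2 * b x * (p x) ^ 2 := by ring
    rw [this]
    positivity
  have hpq : ∀ x ∈ Icc (0 : ℝ) 1, 0 ≤ p x * q x := fun x hx => by
    have := hpqmono (by simp) hx hx.1
    simpa [hq0] using this
  have hppmono : MonotoneOn (fun x => p x * p x) (Icc 0 1) := by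
    refine ac_monotoneOn (hpac.fun_mul hpac) ?_
    filter_upwards [hpd, self_mem_ae_restrict measurableSet_Ioo] with x h1 hx
    refine ⟨_, ?_, h1.mul h1⟩
    have := hpq x (Ioo_subset_Icc_self hx)
    linarith
  have hpne : ∀ x ∈ Icc (0 : ℝ) 1, p x ≠ 0 := fun x hx h0 => by
    have := hppmono (by simp) hx hx.1
    simp only [hp0, h0] at this
    linarith
  have hpcont : ContinuousOn p (Icc 0 1) := by
    simpa [uIcc_of_le (zero_le_one (α := ℝ))] using hpac.continuousOn
  have hppos : ∀ x ∈ Icc (0 : ℝ) 1, 0 < p x := fun x hx => by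
    by_contra hneg
    have hsub : Icc 0 x ⊆ Icc (0 : ℝ) 1 := Icc_subset_Icc_right hx.2
    obtain ⟨z, hz, hz0⟩ := intermediate_value_Icc' hx.1 (hpcont.mono hsub)
      (show (0 : ℝ) ∈ Icc (p x) (p 0) from ⟨not_lt.1 hneg, by rw [hp0]; exact zero_le_one⟩)
    exact hpne z (hsub hz) hz0
  have hβpos : 0 < β := by
    have h1 := hpq 1 (by simp)
    rw [hq1] at h1
    have h2 := hppos 1 (by simp)
    have h3 : 0 ≤ β * (p 1 * p 1) := by linarith
    exact lt_of_le_of_ne (nonneg_of_mul_nonneg_left h3 (by positivity)) (Ne.symm hβ)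
  -- the homogeneous structure `b₂`
  set s : ℝ := Real.sqrt b₂ with hs
  have hs0 : 0 < s := Real.sqrt_pos.2 hb₂
  have hss : s * s = b₂ := Real.mul_self_sqrt hb₂.le
  have hcosh : ∀ t : ℝ, IsODE ((Complex.I * t) ^ 2) (fun _ => b₂)
      (fun x => (Real.cosh (t * s * x) : ℂ)) (fun x => ((t * s * Real.sinh (t * s * x) : ℝ) : ℂ)) :=
    fun t => by
      have hlin : ∀ x : ℝ, HasDerivAt (fun x => t * s * x) (t * s) x := fun x => by
        simpa using (hasDerivAt_id x).const_mul (t * s)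
      refine ⟨fun x _ => ?_, ?_, ?_⟩
      · convert! ((hlin x).cosh.ofReal_comp).hasDerivWithinAt using 1
        push_cast
        ring
      · refine ac_lipschitz_comp Complex.isometry_ofReal.lipschitz ?_
        exact ContDiffOn.absolutelyContinuousOnInterval (by fun_prop)
      · refine Filter.Eventually.of_forall fun x => ?_
        convert! ((hlin x).sinh.const_mul (t * s)).ofReal_comp using 1
        rw [← hss, mul_pow, Complex.I_sq]
        push_cast
        ring
  have hcoshb : (fun _ => b₂) ∈ AdFun b₁ b₂ := ⟨measurable_const, fun _ => ⟨hb₁₂, le_rfl⟩⟩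
  -- A zero `t ≠ 0` of `F` makes `it` a quasi-eigenvalue of the constant `b₂`. As `F 0 = 1`, a
  -- negative value at `β` would give such a zero in `(0, β)`.
  have hF : 0 ≤ Real.cosh (β * s) - s * Real.sinh (β * s) := by
    by_contra hneg
    set F : ℝ → ℝ := fun t => Real.cosh (t * s) - s * Real.sinh (t * s) with hFdef
    have hFc : Continuous F := by fun_prop
    obtain ⟨t, ht, htF⟩ := intermediate_value_Icc' hβpos.le hFc.continuousOn
      (show (0 : ℝ) ∈ Icc (F β) (F 0) from ⟨(not_le.1 hneg).le, by simp [hFdef]⟩)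
    have ht0 : t ≠ 0 := by
      rintro rfl
      simp [hFdef] at htF
    have htβ : t < β := lt_of_le_of_ne ht.2 (by rintro rfl; exact hneg htF.ge)
    refine hmin t ht0 htβ _ hcoshb _ _ ⟨hcosh t, by simp, by simp, ?_⟩
    have h1 : Real.cosh (t * s) = s * Real.sinh (t * s) := by
      simp only [hFdef] at htF; linarith
    simp only [mul_one, h1]
    push_cast
    linear_combination ((t : ℂ) * (s * Complex.sinh (t * s))) * Complex.I_sq
  have hcβ := hcosh β
  rw [hk] at hcβ
  have hw := hode.wronskian hcβ hb.1 measurable_const (M := b₂) hbM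
    (fun _ => (abs_of_pos hb₂).le) (x := 1) (by simp)
  have hint : IntervalIntegrable (fun x => (b₂ - b x) * (p x * Real.cosh (β * s * x))) volume 0 1 := by
    refine IntervalIntegrable.mul_continuousOn ?_ ?_
    · refine intervalIntegrable_of_bound (M := b₂ + b₂) ?_
        (measurable_const.sub hb.1).aestronglyMeasurable
      exact Filter.Eventually.of_forall fun x =>
        (abs_sub _ _).trans (add_le_add (abs_of_pos hb₂).le (hbM x))
    · rw [uIcc_of_le zero_le_one]
      exact hpcont.mul (by fun_prop)
  -- Real form of the Wronskian identity between the mode and the `cosh` solution. With `q 1 = β p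
  -- 1` the left side is `-β p(1) F(β) ≤ 0`, while the integrand on the right is nonnegative.
  have hval : p 1 * (β * s * Real.sinh (β * s)) - q 1 * Real.cosh (β * s)
      = β ^ 2 * ∫ x in (0 : ℝ)..1, (b₂ - b x) * (p x * Real.cosh (β * s * x)) := by
    have e1 : ∫ x in (0 : ℝ)..1, (-((β : ℂ) ^ 2) * b x - -((β : ℂ) ^ 2) * b₂) *
        (y x * (Real.cosh (β * s * x) : ℂ)) = ((β ^ 2 * ∫ x in (0 : ℝ)..1,
          (b₂ - b x) * (p x * Real.cosh (β * s * x)) : ℝ) : ℂ) := by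
      rw [← intervalIntegral.integral_const_mul, ← intervalIntegral.integral_ofReal]
      refine intervalIntegral.integral_congr fun x hx => ?_
      rw [uIcc_of_le zero_le_one] at hx
      rw [(hreal x hx).1]
      push_cast
      ring
    rw [e1, (hreal 1 (by simp)).1, (hreal 1 (by simp)).2, h.deriv_zero] at hw
    simp only [mul_one, mul_zero, Real.sinh_zero, Complex.ofReal_zero, zero_mul, sub_zero] at hw
    exact_mod_cast hw
  have hnn : ∀ x ∈ Icc (0 : ℝ) 1, 0 ≤ (b₂ - b x) * (p x * Real.cosh (β * s * x)) := fun x hx =>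
    mul_nonneg (sub_nonneg.2 (hb.2 x).2) (mul_pos (hppos x hx) (Real.cosh_pos _)).le
  have hle : ∫ x in (0 : ℝ)..1, (b₂ - b x) * (p x * Real.cosh (β * s * x)) ≤ 0 := by
    have h1 : 0 ≤ p 1 * β * (Real.cosh (β * s) - s * Real.sinh (β * s)) :=
      mul_nonneg (mul_pos (hppos 1 (by simp)) hβpos).le hF
    rw [hq1] at hval
    have h2 : β ^ 2 * (∫ x in (0 : ℝ)..1, (b₂ - b x) * (p x * Real.cosh (β * s * x))) ≤ 0 := by
      linarith
    exact nonpos_of_mul_nonpos_right h2 (by positivity)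
  have hzero := le_antisymm hle (intervalIntegral.integral_nonneg zero_le_one hnn)
  rw [intervalIntegral.integral_of_le zero_le_one, integral_Ioc_eq_integral_Ioo,
    integral_eq_zero_iff_of_nonneg_ae
      ((ae_restrict_iff' measurableSet_Ioo).2 (Filter.Eventually.of_forall fun x hx =>
        hnn x (Ioo_subset_Icc_self hx)))
      ((intervalIntegrable_iff_integrableOn_Ioo_of_le zero_le_one).1 hint)] at hzero
  filter_upwards [hzero, self_mem_ae_restrict measurableSet_Ioo] with x hx hx01
  have hx' : (b₂ - b x) * (p x * Real.cosh (β * s * x)) = 0 := hx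
  have := (mul_eq_zero.1 hx').resolve_right
    (mul_pos (hppos x (Ioo_subset_Icc_self hx01)) (Real.cosh_pos _)).ne'
  linarith

/-! ### Rotation of the mode and piecewise constancy. -/

/-- Two functions with nonvanishing Wronskian have finitely many zeros on a compact interval. -/
theorem finite_zeros_of_wronskian {a : ℝ} {P Q P' Q' : ℝ → ℝ}
    (hPc : ContinuousOn P (Icc a 1)) (hQc : ContinuousOn Q (Icc a 1))
    (hP : ∀ x ∈ Ioo a 1, HasDerivAt P (P' x) x) (hQ : ∀ x ∈ Ioo a 1, HasDerivAt Q (Q' x) x)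
    (hW : ∀ x ∈ Ioo a 1, Q' x * P x - Q x * P' x ≠ 0)
    (hne : ∀ x ∈ Icc a 1, Q x = 0 → P x ≠ 0) : {x ∈ Icc a 1 | Q x = 0}.Finite := by
  by_contra hinf
  have hclosed : IsClosed {x ∈ Icc a 1 | Q x = 0} :=
    hQc.preimage_isClosed_of_isClosed isClosed_Icc isClosed_singleton
  obtain ⟨x₀, hx₀, hacc⟩ := Set.Infinite.exists_accPt_of_subset_isCompact hinf
    isCompact_Icc (fun x hx => hx.1)
  have hQ0 : Q x₀ = 0 := ((isClosed_iff_accPt.1 hclosed) x₀ hacc).2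
  have hP0 := hne x₀ hx₀ hQ0
  have hev : ∀ᶠ x in 𝓝[Icc a 1] x₀, P x ≠ 0 := (hPc x₀ hx₀).eventually_ne hP0
  obtain ⟨r, hr, hball⟩ := Metric.mem_nhdsWithin_iff.1 hev
  obtain ⟨x₁, ⟨hx₁r, hx₁⟩, hne₁⟩ := accPt_iff_nhds.1 hacc _ (Metric.ball_mem_nhds x₀ hr)
  have hcv : Convex ℝ (Metric.ball x₀ r ∩ Icc a 1) := (convex_ball x₀ r).inter (convex_Icc a 1)
  have key : ∀ u ∈ Metric.ball x₀ r ∩ Icc a 1, ∀ w ∈ Metric.ball x₀ r ∩ Icc a 1, u < w →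
      Q u = 0 → Q w = 0 → False := by
    intro u hu w hw huw hQu hQw
    have hsub : Icc u w ⊆ Metric.ball x₀ r ∩ Icc a 1 := hcv.ordConnected.out hu hw
    have hsubo : ∀ x ∈ Ioo u w, x ∈ Ioo a 1 := fun x hx =>
      ⟨lt_of_le_of_lt hu.2.1 hx.1, lt_of_lt_of_le hx.2 hw.2.2⟩
    have hPne : ∀ x ∈ Icc u w, P x ≠ 0 := fun x hx => hball (hsub hx)
    -- Rolle for `Q / P`: near an accumulation point of zeros of `Q`, `P` has no zero, and the
    -- numerator of the derivative is the Wronskian.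
    obtain ⟨ξ, hξ, hξ0⟩ := exists_hasDerivAt_eq_zero (f := fun x => Q x / P x)
      (f' := fun x => (Q' x * P x - Q x * P' x) / P x ^ 2) huw
      ((hQc.mono fun x hx => (hsub hx).2).div (hPc.mono fun x hx => (hsub hx).2) hPne)
      (by simp [hQu, hQw]) (fun x hx => (hQ x (hsubo x hx)).div (hP x (hsubo x hx))
        (hPne x (Ioo_subset_Icc_self hx)))
    rcases div_eq_zero_iff.1 hξ0 with h1 | h1
    · exact hW ξ (hsubo ξ hξ) h1
    · exact hPne ξ (Ioo_subset_Icc_self hξ) (pow_eq_zero_iff (two_ne_zero) |>.1 h1)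
  have hm0 : x₀ ∈ Metric.ball x₀ r ∩ Icc a 1 := ⟨Metric.mem_ball_self hr, hx₀⟩
  have hm1 : x₁ ∈ Metric.ball x₀ r ∩ Icc a 1 := ⟨hx₁r, hx₁.1⟩
  rcases lt_or_gt_of_ne hne₁ with hlt | hlt
  · exact key x₁ hm1 x₀ hm0 hlt hx₁.2 hQ0
  · exact key x₀ hm0 x₁ hm1 hlt hQ0 hx₁.2

/-- A function that is constant on every open subinterval of `[0,1]` avoiding a finite set is
piecewise constant. -/
theorem isPiecewiseConstant_of_finite {f : ℝ → ℝ} {Z : Set ℝ} (hZ : Z.Finite)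
    (hf : ∀ p q : ℝ, 0 ≤ p → p < q → q ≤ 1 → Disjoint (Ioo p q) Z →
      ∃ c : ℝ, ∀ x ∈ Ioo p q, f x = c) : IsPiecewiseConstant f := by
  classical
  set T : Finset ℝ := insert 0 (insert 1 (hZ.toFinset.filter fun x => x ∈ Icc (0 : ℝ) 1)) with hT
  have hTIcc : ∀ x ∈ T, x ∈ Icc (0 : ℝ) 1 := fun x hx => by
    simp only [hT, Finset.mem_insert, Finset.mem_filter] at hx
    rcases hx with rfl | rfl | ⟨-, h⟩
    · simp
    · simp
    · exact h
  have h0T : (0 : ℝ) ∈ T := by simp [hT]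
  have h1T : (1 : ℝ) ∈ T := by simp [hT]
  have hcard : 2 ≤ T.card := Finset.one_lt_card.2 ⟨0, h0T, 1, h1T, zero_ne_one⟩
  obtain ⟨n, hn⟩ : ∃ n, T.card = n + 2 := ⟨T.card - 2, by omega⟩
  set p := T.orderEmbOfFin hn
  have hrange : ∀ x ∈ T, ∃ i, p i = x := fun x hx => by
    have : x ∈ range p := by rw [Finset.range_orderEmbOfFin]; exact hx
    exact this
  have hpT : ∀ i, p i ∈ T := fun i => Finset.orderEmbOfFin_mem T hn i
  refine ⟨n, p, p.strictMono, ?_, ?_, fun i => ?_⟩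
  · obtain ⟨i, hi⟩ := hrange 0 h0T
    exact le_antisymm (hi ▸ p.monotone (Fin.zero_le i)) (hTIcc _ (hpT 0)).1
  · obtain ⟨i, hi⟩ := hrange 1 h1T
    exact le_antisymm (hTIcc _ (hpT _)).2 (hi ▸ p.monotone (Fin.le_last i))
  · have hlt : p i.castSucc < p i.succ := p.strictMono Fin.castSucc_lt_succ
    have hl := (hTIcc _ (hpT i.castSucc)).1
    have hr := (hTIcc _ (hpT i.succ)).2
    refine hf _ _ hl hlt hr (Set.disjoint_left.2 fun x hx hxZ => ?_)
    have hxT : x ∈ T := by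
      simp only [hT, Finset.mem_insert, Finset.mem_filter, Set.Finite.mem_toFinset]
      exact Or.inr (Or.inr ⟨hxZ, hl.trans hx.1.le, hx.2.le.trans hr⟩)
    obtain ⟨j, rfl⟩ := hrange x hxT
    have h1 : i.castSucc < j := p.lt_iff_lt.1 hx.1
    have h2 : j < i.succ := p.lt_iff_lt.1 hx.2
    rw [Fin.lt_def] at h1 h2
    simp at h1 h2
    omega

/-- The level sets of a piecewise constant function are finite unions of intervals. -/
theorem isFiniteUnionOfIntervals_levelSet {f : ℝ → ℝ} (hf : IsPiecewiseConstant f) {B : LInf01}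
    (hB : ∀ᵐ x ∂vol01, B x = f x) (c : ℝ) : IsFiniteUnionOfIntervals (levelSet B c) := by
  obtain ⟨n, p, hp, hp0, hp1, hconst⟩ := hf
  set S : Set (Set ℝ) := {J | ∃ i : Fin (n + 1), J = Ioo (p i.castSucc) (p i.succ) ∧
    ∀ x ∈ J, f x = c} with hS
  refine ⟨S, ?_, ?_, ?_⟩
  · refine (Set.finite_range fun i : Fin (n + 1) => Ioo (p i.castSucc) (p i.succ)).subset ?_
    rintro J ⟨i, rfl, -⟩
    exact ⟨i, rfl⟩
  · rintro J ⟨i, rfl, -⟩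
    exact ordConnected_Ioo
  · have hnull : ∀ᵐ x ∂vol01, x ∉ range p :=
      ae_restrict_of_ae ((Set.finite_range p).countable.ae_notMem volume)
    rw [Filter.eventuallyEq_set]
    filter_upwards [hB, hnull, self_mem_ae_restrict measurableSet_Ioo] with x hx hxp hx01
    have hlev : x ∈ levelSet B c ↔ f x = c := by
      simp only [levelSet, mem_ofPred_eq, Ioo_subset_Icc_self hx01, true_and, hx]
    rw [hlev]
    constructor
    · intro hfx
      -- The last partition point below `x` identifies the interval containing `x`; partition points
      -- themselves form a null set.
      obtain ⟨i, hi, hmax⟩ := Finset.exists_max_image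
        (Finset.univ.filter fun j : Fin (n + 2) => p j < x) id ⟨0, by simp [hp0, hx01.1]⟩
      simp only [Finset.mem_filter, Finset.mem_univ, true_and, id_eq] at hi hmax
      have hil : i ≠ Fin.last (n + 1) := by
        rintro rfl
        rw [hp1] at hi
        exact lt_asymm hi hx01.2
      obtain ⟨k, rfl⟩ := Fin.exists_castSucc_eq.2 hil
      have hk : x < p k.succ := by
        refine lt_of_le_of_ne (not_lt.1 fun hlt => ?_) fun h => hxp ⟨_, h.symm⟩
        exact absurd (hmax _ hlt) (not_le.2 Fin.castSucc_lt_succ)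
      obtain ⟨d, hd⟩ := hconst k
      refine ⟨_, ⟨k, rfl, fun z hz => ?_⟩, ⟨hi, hk⟩⟩
      rw [hd z hz, ← hd x ⟨hi, hk⟩, hfx]
    · rintro ⟨J, ⟨i, -, hJc⟩, hxJ⟩
      exact hJc x hxJ

section Structure

variable {b₁ b₂ : ℝ} {b : ℝ → ℝ} {y v : ℝ → ℂ} {κ : ℂ}

/-- The rotation identity `Im (y' ȳ)(x) = -2 (Re κ) (Im κ) ∫₀ˣ b |y|²`. -/
theorem IsMode.im_deriv_mul_conj (h : IsMode κ b y v) (hb : Measurable b) {M : ℝ}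
    (hM : ∀ x, |b x| ≤ M) {x : ℝ} (hx : x ∈ Icc (0 : ℝ) 1) :
    (v x * conj (y x)).im = -2 * κ.re * κ.im * ∫ s in (0 : ℝ)..x, b s * ‖y s‖ ^ 2 := by
  have hw := h.ode.wronskian h.ode.conjugate hb hb hM hM hx
  simp only [h.deriv_zero, map_zero, mul_zero, zero_mul, sub_zero] at hw
  have e1 : ∫ s in (0 : ℝ)..x, (κ ^ 2 * b s - conj (κ ^ 2) * b s) * (y s * conj (y s))
      = 4 * κ.re * κ.im * Complex.I * ((∫ s in (0 : ℝ)..x, b s * ‖y s‖ ^ 2 : ℝ) : ℂ) := by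
    rw [← intervalIntegral.integral_ofReal, ← intervalIntegral.integral_const_mul]
    refine intervalIntegral.integral_congr fun s _ => ?_
    have h1 : κ ^ 2 - conj (κ ^ 2) = 4 * κ.re * κ.im * Complex.I := by
      apply Complex.ext <;> simp [pow_two]
      ring
    simp only [← sub_mul, h1, Complex.mul_conj']
    push_cast
    ring
  rw [e1] at hw
  have h2 := congrArg Complex.im hw
  simp at h2
  simp
  linarith

/-- A bang-bang structure of nonzero frequency is piecewise constant. -/
theorem exists_piecewiseConstant (hb₁ : 0 ≤ b₁) (hb : b ∈ AdFun b₁ b₂)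
    (h : IsMode κ b y v) (hα : κ.re ≠ 0) {c : ℂ} (hc : c ≠ 0) (hbb : ∀ᵐ x ∂vol01,
      (0 < (c * y x ^ 2).re → b x = b₂) ∧ ((c * y x ^ 2).re < 0 → b x = b₁)) :
    ∃ f : ℝ → ℝ, IsPiecewiseConstant f ∧ (∀ x, f x = b₁ ∨ f x = b₂) ∧
      ∀ᵐ x ∂vol01, b x = f x := by
  have hbM := AdFun.abs_le hb₁ hb
  have hyc := h.ode.continuousOn
  set N : ℝ → ℝ := fun x => ∫ s in (0 : ℝ)..x, b s * ‖y s‖ ^ 2 with hN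
  have hnn : ∀ x, 0 ≤ b x * ‖y x‖ ^ 2 := fun x =>
    mul_nonneg (hb₁.trans (hb.2 x).1) (sq_nonneg _)
  have hint : IntervalIntegrable (fun s => b s * ‖y s‖ ^ 2) volume 0 1 := by
    refine IntervalIntegrable.mul_continuousOn ?_ ?_
    · exact intervalIntegrable_of_bound (M := b₂) (Filter.Eventually.of_forall hbM)
        hb.1.aestronglyMeasurable
    · rw [uIcc_of_le zero_le_one]
      exact hyc.norm.pow 2
  have hint' : ∀ x ∈ Icc (0 : ℝ) 1, IntervalIntegrable (fun s => b s * ‖y s‖ ^ 2) volume 0 x :=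
    fun x hx => hint.mono_set (by
      rw [uIcc_of_le hx.1, uIcc_of_le zero_le_one]; exact Icc_subset_Icc_right hx.2)
  have hNc : ContinuousOn N (Icc 0 1) := by
    have := intervalIntegral.continuousOn_primitive_interval' hint (a := 0) left_mem_uIcc
    rwa [uIcc_of_le zero_le_one] at this
  -- At `x = 1` the boundary condition turns the rotation identity into `-Re κ |y(1)|²`, which is
  -- nonzero; this also yields `Im κ ≠ 0`.
  have hprod : -2 * κ.re * κ.im * N 1 ≠ 0 := fun h0 => by
    have h1 := h.im_deriv_mul_conj hb.1 hbM (x := 1) (by simp)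
    have h2 : -(Complex.I * κ * y 1) * conj (y 1) = -(Complex.I * κ * (‖y 1‖ : ℂ) ^ 2) := by
      rw [← Complex.mul_conj']; ring
    rw [show _ = _ from h0, h.deriv_one, h2, ← Complex.ofReal_pow] at h1
    have h3 : κ.re * ‖y 1‖ ^ 2 = 0 := by
      simpa [-Complex.ofReal_pow] using h1
    rcases mul_eq_zero.1 h3 with h4 | h4
    · exact hα h4
    · exact h.val_one_ne_zero hbM (by simpa using h4)
  have hβ : κ.im ≠ 0 := right_ne_zero_of_mul (left_ne_zero_of_mul hprod)
  -- `a` is the last zero of `N`. Up to `a` we have `b |y|² = 0` a.e., so the mode does not move;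
  -- beyond `a` it rotates strictly.
  obtain ⟨a, ⟨ha, hNa⟩, hamax⟩ : ∃ a, IsGreatest {x ∈ Icc (0 : ℝ) 1 | N x = 0} a := by
    refine IsCompact.exists_isGreatest ?_ ⟨0, by simp, by simp [hN]⟩
    exact isCompact_Icc.of_isClosed_subset
      (hNc.preimage_isClosed_of_isClosed isClosed_Icc isClosed_singleton) fun x hx => hx.1
  have hNgt : ∀ x ∈ Icc a 1, x ≠ a → N x ≠ 0 := fun x hx hne h0 =>
    hne (le_antisymm (hamax ⟨⟨ha.1.trans hx.1, hx.2⟩, h0⟩) hx.1)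
  have hae : ∀ᵐ x, x ∈ Ioc 0 a → b x * ‖y x‖ ^ 2 = 0 := by
    have h0 := hNa
    simp only [hN] at h0
    rw [intervalIntegral.integral_of_le ha.1, integral_eq_zero_iff_of_nonneg hnn (hint' a ha).1] at h0
    exact (ae_restrict_iff' measurableSet_Ioc).1 h0
  -- The Wronskian identity against the constant solution `1` of the equation with `k = 0` reads
  -- `v(x) = -κ² ∫₀ˣ b y`.
  have hv : ∀ x ∈ Icc (0 : ℝ) a, v x = 0 := fun x hx => by
    have hone : IsODE 0 b (fun _ => 1) (fun _ => 0) :=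
      ⟨fun x _ => hasDerivWithinAt_const _ _ _,
        (LipschitzWith.const (0 : ℂ)).lipschitzOnWith.absolutelyContinuousOnInterval,
        Filter.Eventually.of_forall fun x => by simpa using hasDerivAt_const x (0 : ℂ)⟩
    have hw := h.ode.wronskian hone hb.1 hb.1 hbM hbM (x := x) ⟨hx.1, hx.2.trans ha.2⟩
    have hz : ∫ s in (0 : ℝ)..x, (κ ^ 2 * b s - 0 * b s) * (y s * 1) = 0 := by
      refine intervalIntegral.integral_zero_ae ?_
      filter_upwards [hae] with s hs hs'
      rw [uIoc_of_le hx.1] at hs'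
      rcases mul_eq_zero.1 (hs ⟨hs'.1, hs'.2.trans hx.2⟩) with h1 | h1
      · simp [h1]
      · have : y s = 0 := by simpa using h1
        simp [this]
    rw [hz, h.deriv_zero] at hw
    simpa using hw
  have hyone : ∀ x ∈ Icc (0 : ℝ) a, y x = 1 := fun x hx => by
    have hsub : Icc 0 a ⊆ Icc (0 : ℝ) 1 := Icc_subset_Icc_right ha.2
    have := constant_of_has_deriv_right_zero (f := y) (a := 0) (b := a) (hyc.mono hsub)
      (fun z hz => by
        have h1 := h.ode.hasDeriv z (hsub (Ico_subset_Icc_self hz))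
        rw [hv z (Ico_subset_Icc_self hz)] at h1
        refine h1.mono_of_mem_nhdsWithin ?_
        exact Icc_mem_nhdsGE_of_mem ⟨hz.1, hz.2.trans_le ha.2⟩) x hx
    rw [this, h.val_zero]
  have hbzero : ∀ᵐ x, x ∈ Ioc 0 a → b x = b₁ := by
    filter_upwards [hae] with x hx hm
    have h1 := hx hm
    rw [hyone x (Ioc_subset_Icc_self hm)] at h1
    have h2 := (hb.2 x).1
    simp at h1
    linarith
  have hyne : ∀ x ∈ Icc a 1, y x ≠ 0 := fun x hx h0 => by
    by_cases hxa : x = a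
    · rw [hxa, hyone a ⟨ha.1, le_rfl⟩] at h0
      exact one_ne_zero h0
    · have h1 := h.im_deriv_mul_conj hb.1 hbM (x := x) ⟨ha.1.trans hx.1, hx.2⟩
      rw [h0] at h1
      simp only [map_zero, mul_zero, Complex.zero_im] at h1
      exact (mul_ne_zero (mul_ne_zero (mul_ne_zero (by norm_num) hα) hβ) (hNgt x hx hxa)) h1.symm
  -- With `e² = 2ic`, `Re (c y²)` factors as `Re (e y) · Im (e y)`. The Wronskian of the two factors
  -- is `|e|² Im (y' ȳ)`, nonzero on `(a, 1)`, so each has finitely many zeros on `[a, 1]`.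
  obtain ⟨e, he⟩ := IsAlgClosed.exists_pow_nat_eq (2 * Complex.I * c) (n := 2) (by norm_num)
  have he0 : e ≠ 0 := by
    rintro rfl
    simp [hc] at he
  have hfac : ∀ x, (c * y x ^ 2).re = (e * y x).re * (e * y x).im := fun x => by
    have h1 : (e * y x) ^ 2 = 2 * Complex.I * (c * y x ^ 2) := by rw [mul_pow, he]; ring
    have h2 := congrArg Complex.im h1
    have h3 : (2 * Complex.I * (c * y x ^ 2)).im = 2 * (c * y x ^ 2).re := by
      simp [mul_assoc]
    have h4 : ((e * y x) ^ 2).im = 2 * ((e * y x).re * (e * y x).im) := by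
      rw [pow_two, Complex.mul_im]; ring
    linarith
  have hsub : Icc a 1 ⊆ Icc (0 : ℝ) 1 := Icc_subset_Icc_left ha.1
  have hd : ∀ x ∈ Ioo a 1, HasDerivAt (fun x => e * y x) (e * v x) x := fun x hx =>
    (h.ode.hasDerivAt ⟨ha.1.trans_lt hx.1, hx.2⟩).const_mul e
  have hdr : ∀ x ∈ Ioo a 1, HasDerivAt (fun x => (e * y x).re) (e * v x).re x := fun x hx =>
    Complex.reCLM.hasFDerivAt.comp_hasDerivAt x (hd x hx)
  have hdi : ∀ x ∈ Ioo a 1, HasDerivAt (fun x => (e * y x).im) (e * v x).im x := fun x hx =>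
    Complex.imCLM.hasFDerivAt.comp_hasDerivAt x (hd x hx)
  have hec : ContinuousOn (fun x => e * y x) (Icc a 1) := continuousOn_const.mul (hyc.mono hsub)
  have hrc : ContinuousOn (fun x => (e * y x).re) (Icc a 1) :=
    Complex.continuous_re.comp_continuousOn hec
  have hic : ContinuousOn (fun x => (e * y x).im) (Icc a 1) :=
    Complex.continuous_im.comp_continuousOn hec
  have hW : ∀ x ∈ Ioo a 1,
      (e * v x).im * (e * y x).re - (e * y x).im * (e * v x).re ≠ 0 := fun x hx h0 => by
    have h1 : (e * v x).im * (e * y x).re - (e * y x).im * (e * v x).re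
        = ‖e‖ ^ 2 * (v x * conj (y x)).im := by
      rw [Complex.sq_norm, Complex.normSq_apply]
      simp
      ring
    rw [h1, h.im_deriv_mul_conj hb.1 hbM (hsub (Ioo_subset_Icc_self hx))] at h0
    refine mul_ne_zero (pow_ne_zero 2 (norm_ne_zero_iff.2 he0)) ?_ h0
    exact mul_ne_zero (mul_ne_zero (mul_ne_zero (by norm_num) hα) hβ)
      (hNgt x (Ioo_subset_Icc_self hx) hx.1.ne')
  have hne : ∀ x ∈ Icc a 1, (e * y x).im = 0 → (e * y x).re ≠ 0 := fun x hx h1 h2 =>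
    mul_ne_zero he0 (hyne x hx) (Complex.ext h2 h1)
  have hfin1 := finite_zeros_of_wronskian hrc hic hdr hdi hW hne
  have hfin2 := finite_zeros_of_wronskian hic hrc hdi hdr
    (fun x hx h0 => hW x hx (by linarith)) (fun x hx h1 h2 => hne x hx h2 h1)
  set g : ℝ → ℝ := fun x => (c * y x ^ 2).re with hg
  have hgc : ContinuousOn g (Icc a 1) := by
    simp only [hg, hfac]
    exact hrc.mul hic
  -- The point `a` is added because the formula for the piecewise constant function changes there.
  set Z : Set ℝ := insert a {x ∈ Icc a 1 | g x = 0} with hZ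
  have hZfin : Z.Finite := by
    refine Set.Finite.insert a ((hfin1.union hfin2).subset fun x hx => ?_)
    have h1 : (e * y x).re * (e * y x).im = 0 := by rw [← hfac]; exact hx.2
    rcases mul_eq_zero.1 h1 with h2 | h2
    · exact Or.inr ⟨hx.1, h2⟩
    · exact Or.inl ⟨hx.1, h2⟩
  refine ⟨fun x => if x ≤ a then b₁ else if 0 < g x then b₂ else b₁,
    isPiecewiseConstant_of_finite hZfin ?_, ?_, ?_⟩
  · intro p q hp hpq hq hdis
    have haZ : a ∉ Ioo p q := fun hm => Set.disjoint_left.1 hdis hm (Set.mem_insert a _)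
    rcases le_or_gt q a with hqa | hqa
    · exact ⟨b₁, fun x hx => if_pos (hx.2.le.trans hqa)⟩
    have hap : a ≤ p := not_lt.1 fun hlt => haZ ⟨hlt, hqa⟩
    have hIcc : Ioo p q ⊆ Icc a 1 := fun x hx => ⟨hap.trans hx.1.le, hx.2.le.trans hq⟩
    have hg0 : ∀ x ∈ Ioo p q, g x ≠ 0 := fun x hx h0 =>
      Set.disjoint_left.1 hdis hx (Set.mem_insert_of_mem a ⟨hIcc hx, h0⟩)
    have hxa : ∀ x ∈ Ioo p q, ¬ x ≤ a := fun x hx => not_le.2 (hap.trans_lt hx.1)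
    by_cases hpos : ∃ x ∈ Ioo p q, 0 < g x
    · obtain ⟨x, hx, hgx⟩ := hpos
      refine ⟨b₂, fun z hz => ?_⟩
      have hgz : 0 < g z := by
        by_contra hneg
        obtain ⟨w, hw, hw0⟩ := isPreconnected_Ioo.intermediate_value hz hx (hgc.mono hIcc)
          (show (0 : ℝ) ∈ Icc (g z) (g x) from ⟨not_lt.1 hneg, hgx.le⟩)
        exact hg0 w hw hw0
      simp [hxa z hz, hgz]
    · push Not at hpos
      refine ⟨b₁, fun z hz => ?_⟩
      simp [hxa z hz, (hpos z hz).not_gt]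
  · intro x
    simp only
    split_ifs <;> simp
  · have hnull : ∀ᵐ x ∂vol01, x ∉ Z := ae_restrict_of_ae (hZfin.countable.ae_notMem volume)
    filter_upwards [hbb, hnull, ae_restrict_of_ae hbzero,
      self_mem_ae_restrict measurableSet_Ioo] with x hx hxZ hx0 hx01
    by_cases hxa : x ≤ a
    · simp only [if_pos hxa]
      exact hx0 ⟨hx01.1, hxa⟩
    · simp only [if_neg hxa]
      have hg0 : g x ≠ 0 := fun h0 =>
        hxZ (Set.mem_insert_of_mem a ⟨⟨(not_le.1 hxa).le, hx01.2.le⟩, h0⟩)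
      rcases lt_or_gt_of_ne hg0 with hlt | hgt
      · rw [if_neg hlt.not_gt]
        exact hx.2 hlt
      · rw [if_pos hgt]
        exact hx.1 hgt

end Structure

/-! ### Extreme points and the conclusion. -/

/-- Coefficients with values in `{b₁, b₂}` are extreme points of the admissible family. -/
theorem mem_Ext_of_ae {b₁ b₂ : ℝ} {B : LInf01} (hB : B ∈ Ad b₁ b₂)
    (h : ∀ᵐ x ∂vol01, B x = b₁ ∨ B x = b₂) : B ∈ Ext b₁ b₂ := by
  refine mem_extremePoints.2 ⟨hB, fun X hX Y hY hBXY => ?_⟩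
  obtain ⟨p, q, hp, hq, hpq, hsum⟩ := hBXY
  have hX' : ∀ᵐ x ∂vol01, b₁ ≤ X x ∧ X x ≤ b₂ := hX
  have hY' : ∀ᵐ x ∂vol01, b₁ ≤ Y x ∧ Y x ≤ b₂ := hY
  have hpt : ∀ᵐ x ∂vol01, X x = B x ∧ Y x = B x := by
    have e0 := Lp.coeFn_add (p • X) (q • Y)
    rw [hsum] at e0
    filter_upwards [e0, Lp.coeFn_smul p X, Lp.coeFn_smul q Y, hX', hY', h]
      with x e0 e1 e2 hx hy hb
    rw [Pi.add_apply, e1, e2] at e0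
    simp only [Pi.smul_apply, smul_eq_mul] at e0
    obtain rfl : q = 1 - p := by linarith
    -- An endpoint of `[b₁, b₂]` is a proper convex combination of points of the interval only
    -- trivially.
    rcases hb with hb | hb <;> rw [hb] at e0 ⊢ <;> constructor <;> nlinarith
  exact ⟨Lp.ext (hpt.mono fun x hx => hx.1), Lp.ext (hpt.mono fun x hx => hx.2)⟩

/-- An optimal structure has a piecewise constant representative with values `b₁` and `b₂`. -/
theorem IsOptimal.exists_piecewiseConstant {b₁ b₂ : ℝ} (hb₁ : 0 ≤ b₁) (hb₁₂ : b₁ ≤ b₂)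
    (hb₂ : 0 < b₂) {α : ℝ} {B : LInf01} (hB : IsOptimal b₁ b₂ α B) :
    ∃ f : ℝ → ℝ, IsPiecewiseConstant f ∧ (∀ x, f x = b₁ ∨ f x = b₂) ∧
      ∀ᵐ x ∂vol01, B x = f x := by
  obtain ⟨hBad, β, hI, hK⟩ := hB
  obtain ⟨b, hb, hBb, hκ, y, v, hmode⟩ := exists_isMode hb₁ hb₁₂ hBad hK
  have hlow : ∀ κ' ∈ KAd b₁ b₂, κ'.re = α → β ≤ κ'.im := fun κ' hκ' hre => by
    have h1 : I b₁ b₂ α ≤ (κ'.im : EReal) := sInf_le ⟨κ', hκ', hre, rfl⟩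
    rw [hI] at h1
    exact_mod_cast h1
  suffices ∃ f : ℝ → ℝ, IsPiecewiseConstant f ∧ (∀ x, f x = b₁ ∨ f x = b₂) ∧
      ∀ᵐ x ∂vol01, b x = f x by
    obtain ⟨f, hf, hval, hae⟩ := this
    refine ⟨f, hf, hval, ?_⟩
    filter_upwards [hBb, hae] with x h1 h2 using h1.trans h2
  -- For `α = 0` the rotation identity is void; for `α ≠ 0` moving straight down never meets the
  -- excluded value `κ = 0`.
  by_cases hα : α = 0
  · subst hα
    simp only [Complex.ofReal_zero, zero_add] at hκ hmode
    have hβ : β ≠ 0 := by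
      rintro rfl
      simp at hκ
    refine ⟨fun _ => b₂, isPiecewiseConstant_of_finite Set.finite_empty
      fun p q _ _ _ _ => ⟨b₂, fun _ _ => rfl⟩, fun _ => Or.inr rfl, ?_⟩
    refine ae_eq_of_imaginary_mode hb₁ hb₁₂ hb₂ hb hβ hmode fun t ht htβ b' hb' z u hzu => ?_
    have hmem := hzu.mem_KAd hb₁ (mul_ne_zero Complex.I_ne_zero (by exact_mod_cast ht)) hb'
    have := hlow _ hmem (by simp)
    simp at this
    linarith
  · have hre : ((α : ℂ) + Complex.I * β).re = α := by simp
    obtain ⟨c, hc, hbb⟩ := bang_bang hb₁ hb₁₂ hb hmode hκ fun t ht b' hb' z u hzu => by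
      have hre' : ((α : ℂ) + Complex.I * β - Complex.I * t).re = α := by simp
      have hne : (α : ℂ) + Complex.I * β - Complex.I * t ≠ 0 := fun h0 => by
        rw [h0] at hre'
        exact hα (by simpa using hre'.symm)
      have := hlow _ (hzu.mem_KAd hb₁ hne hb') hre'
      simp at this
      linarith
    exact QuasiEig.exists_piecewiseConstant hb₁ hb hmode (by rwa [hre]) hc hbb

end QuasiEig

theorem theorem2p2 (b₁ b₂ : ℝ) (hb₁ : 0 ≤ b₁) (hb₁₂ : b₁ ≤ b₂) (hb₂ : 0 < b₂)
    (α : ℝ) (B : QuasiEig.LInf01) (hB : QuasiEig.IsOptimal b₁ b₂ α B) :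
    B ∈ QuasiEig.ExtS b₁ b₂ ∧
      ∃ f : ℝ → ℝ, QuasiEig.IsPiecewiseConstant f ∧
        (∀ x ∈ Set.Icc (0 : ℝ) 1, f x = b₁ ∨ f x = b₂) ∧
        ∀ᵐ x ∂QuasiEig.vol01, B x = f x := by
  obtain ⟨f, hf, hval, hae⟩ := hB.exists_piecewiseConstant hb₁ hb₁₂ hb₂
  refine ⟨⟨QuasiEig.mem_Ext_of_ae hB.1 ?_, QuasiEig.isFiniteUnionOfIntervals_levelSet hf hae _,
    QuasiEig.isFiniteUnionOfIntervals_levelSet hf hae _⟩, f, hf, fun x _ => hval x, hae⟩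
  filter_upwards [hae] with x hx
  rw [hx]
  exact hval x
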